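/- Let $n\ge 2$, let $\mathbb{L}^{n+1}=\mathbb{R}^{n+1}$ carry $\langle x,y\rangle_L=x_1y_1+\dots+x_ny_n-x_{n+1}y_{n+1}$, let $\mathbb{H}^n=\{p\in\mathbb{L}^{n+1}:\langle p,p\rangle_L=-1,\ p_{n+1}>0\}$, and let $\mathbb{H}^n\times_{-1}\mathbb{R}$ be the product with the Lorentzian metric $g_{\mathbb{H}^n}-dt^2$. For $p\in\mathbb H^n$ put $\tau(p)=\ln\big(\sqrt{p_{n+1}^2-1}+p_{n+1}\big)$, the distance from $p$ to $(0,\dots,0,1)$. The group $SO(n)$ acts on $\mathbb{H}^n\times_{-1}\mathbb{R}$ by rotating the coordinates $p_1,\dots,p_n$. A *translator* is a smooth immersed hypersurface with non-degenerate induced metric whose mean curvature vector (the trace of the second fundamental form) satisfies $\mathbf{H}=(\partial_t)^\perp$. It is *time-like* if its induced metric is Lorentzian, and *rotationally invariant* if its image is invariant under $SO(n)$. A *spindle* is a set $\{(p,t)\in\mathbb{H}^n\times\mathbb{R}: a<t<b,\ \tau(p)=g(t)\}$ for which there are real numbers $a<t_0<b$ and $r>0$ and functions $g,f_+,f_-$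 such that: 1. $g:(a,b)\to(0,\infty)$ is smooth, $g''=(g'^2-1)\big((n-1)\coth(g)-g'\big)$, $g(t_0)=r$ and $g'(t_0)=0$; 2. $f_\pm:(0,r)\to\mathbb{R}$ are smooth and satisfy $f''(s)=(1-f'(s)^2)\big(1-(n-1)\coth(s)f'(s)\big)$, with $f_+'>1$ and $f_-'<-1$; 3. $f_+$ takes values in $(a,t_0)$, $f_-$ takes values in $(t_0,b)$, and $g(f_\pm(s))=s$ for all $s\in(0,r)$; 4. as $s\to 0^+$: $f_+\to a$, $f_+'\to 1$, $f_-\to b$, $f_-'\to -1$; as $s\to r^-$: $f_\pm\to t_0$ and $f_\pm'\to\pm\infty$. Thus a spindle is a smooth bigraph, the union of the graphs of $f_+\circ\tau$ and $f_-\circ\tau$ over $\{0<\tau<r\}$ and of the sphere $\{\tau=r,\ t=t_0\}$. **Theorem.** Every connected, rotationally invariant, time-like translator in $\mathbb{H}^n\times_{-1}\mathbb{R}$ is an open subset of a spindle; that is, there is a spindle $\Sigma$ such that the image of the translator is a relatively open subset of $\Sigma$. -/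

import Mathlib

open scoped Manifold ContDiff Topology

noncomputable section

namespace HESU

/-- The vector space `𝕃ⁿ⁺¹ × ℝ`; a point is `(x, y, t)` with `x = (p₁, …, pₙ)`, `y = pₙ₊₁` and
`t` the coordinate of the factor `ℝ`. -/
abbrev Ambient (n : ℕ) : Type := EuclideanSpace ℝ (Fin n) × ℝ × ℝ

/-- The flat metric `⟨·,·⟩_L - dt²` of `𝕃ⁿ⁺¹ × ℝ`. -/
def metric {n : ℕ} (v w : Ambient n) : ℝ :=
  inner ℝ v.1 w.1 - v.2.1 * w.2.1 - v.2.2 * w.2.2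

/-- The static universe `ℍⁿ ×₋₁ ℝ`, with `ℍⁿ = {p ∈ 𝕃ⁿ⁺¹ | ⟨p, p⟩_L = -1, pₙ₊₁ > 0}`. Its
Lorentzian metric `g_{ℍⁿ} - dt²` is the restriction of `metric` to its tangent spaces. -/
def space (n : ℕ) : Set (Ambient n) :=
  {q | inner ℝ q.1 q.1 - q.2.1 * q.2.1 = -1 ∧ 0 < q.2.1}

/-- The unit vector field `∂ₜ`. -/
def timeVector (n : ℕ) : Ambient n := (0, 0, 1)

/-- The position vector `χ` of the factor `ℍⁿ`: at points of `space n` it is normal to `space n`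
and `⟨χ, χ⟩ = -1`. -/
def position {n : ℕ} (q : Ambient n) : Ambient n := (q.1, q.2.1, 0)

/-- The hyperbolic distance of the `ℍⁿ`-component to the pole `(0, …, 0, 1)`, namely
`τ = ln (√(ρ² - 1) + ρ)` with `ρ = pₙ₊₁`. -/
def tau {n : ℕ} (q : Ambient n) : ℝ :=
  Real.log (Real.sqrt (q.2.1 ^ 2 - 1) + q.2.1)

/-- The action on `𝕃ⁿ⁺¹ × ℝ` of a linear map of the first `n` coordinates. -/
def rotate {n : ℕ} (A : EuclideanSpace ℝ (Fin n) ≃ₗᵢ[ℝ] EuclideanSpace ℝ (Fin n))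
    (q : Ambient n) : Ambient n :=
  (A q.1, q.2.1, q.2.2)

/-- Invariance of a set under `SO(n)`. -/
def RotationallyInvariant {n : ℕ} (S : Set (Ambient n)) : Prop :=
  ∀ A : EuclideanSpace ℝ (Fin n) ≃ₗᵢ[ℝ] EuclideanSpace ℝ (Fin n),
    LinearMap.det (A.toLinearEquiv : EuclideanSpace ℝ (Fin n) →ₗ[ℝ] EuclideanSpace ℝ (Fin n)) = 1 →
      ∀ q ∈ S, rotate A q ∈ S

section Immersion

variable {n : ℕ} {M : Type*} [TopologicalSpace M] [ChartedSpace (EuclideanSpace ℝ (Fin n)) M]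

/-- The map `F` read in the chart around `x`. -/
def localParam (F : M → Ambient n) (x : M) : EuclideanSpace ℝ (Fin n) → Ambient n :=
  F ∘ (extChartAt (𝓡 n) x).symm

/-- The `i`-th coordinate vector at `x`, `∂ᵢF`, in the chart around `x`. -/
def tangentVec (F : M → Ambient n) (x : M) (i : Fin n) : Ambient n :=
  fderiv ℝ (localParam F x) (extChartAt (𝓡 n) x x) (EuclideanSpace.single i 1)

/-- The second partial derivative at `x`, `∂ᵢ∂ⱼF`, in the chart around `x`. -/
def secondDeriv (F : M → Ambient n) (x : M) (i j : Fin n) : Ambient n :=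
  fderiv ℝ (fderiv ℝ (localParam F x)) (extChartAt (𝓡 n) x x)
    (EuclideanSpace.single i 1) (EuclideanSpace.single j 1)

/-- The Gram matrix `gᵢⱼ = ⟨∂ᵢF, ∂ⱼF⟩` of the induced metric at `x`. -/
def inducedMetric (F : M → Ambient n) (x : M) : Matrix (Fin n) (Fin n) ℝ :=
  Matrix.of fun i j => metric (tangentVec F x i) (tangentVec F x j)

/-- The component `w^⊥` of a vector `w` of `𝕃ⁿ⁺¹ × ℝ` in the normal line of the hypersurface `F`
inside the tangent space of `ℍⁿ ×₋₁ ℝ` at `F x`: remove from `w` its component along `χ` and its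
component tangent to the hypersurface. -/
def normalPart (F : M → Ambient n) (x : M) (w : Ambient n) : Ambient n :=
  w + metric w (position (F x)) • position (F x)
    - ∑ i, ∑ j, ((inducedMetric F x)⁻¹ i j * metric w (tangentVec F x i)) • tangentVec F x j

/-- The second fundamental form `II(∂ᵢ, ∂ⱼ) = (∇̄_{∂ᵢ} ∂ⱼF)^⊥`. The Levi-Civita connection `∇̄` of
`ℍⁿ ×₋₁ ℝ` differs from the flat derivative of `𝕃ⁿ⁺¹ × ℝ` by a multiple of `χ`, which
`normalPart` removes. -/
def secondFundamentalForm (F : M → Ambient n) (x : M) (i j : Fin n) : Ambient n :=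
  normalPart F x (secondDeriv F x i j)

/-- The mean curvature vector, the trace of the second fundamental form in the induced metric. -/
def meanCurvatureVector (F : M → Ambient n) (x : M) : Ambient n :=
  ∑ i, ∑ j, (inducedMetric F x)⁻¹ i j • secondFundamentalForm F x i j

/-- `F` is a smooth time-like immersed hypersurface of `ℍⁿ ×₋₁ ℝ`: the induced metric is
non-degenerate (in particular `F` is an immersion) and Lorentzian, that is, there is a time-like
tangent vector at each point. -/
structure IsTimelikeHypersurface (F : M → Ambient n) : Prop where
  smooth : ContMDiff (𝓡 n) 𝓘(ℝ, Ambient n) ∞ F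
  mem_space : ∀ x, F x ∈ space n
  nondegenerate : ∀ x, (inducedMetric F x).det ≠ 0
  timelike : ∀ x, ∃ c : Fin n → ℝ,
    metric (∑ i, c i • tangentVec F x i) (∑ i, c i • tangentVec F x i) < 0

/-- The translator equation `𝐇 = (∂ₜ)^⊥`. -/
def IsTranslator (F : M → Ambient n) : Prop :=
  ∀ x, meanCurvatureVector F x = normalPart F x (timeVector n)

end Immersion

/-- `f` solves `f'' = (1 - f'²)(1 - (n-1) coth(s) f')` on `(0, r)`, the equation of the rotational
graphical translators `t = f(τ)`. -/
def SolvesGraphODE (n : ℕ) (r : ℝ) (f : ℝ → ℝ) : Prop :=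
  ContDiffOn ℝ ∞ f (Set.Ioo 0 r) ∧
    ∀ s ∈ Set.Ioo 0 r, deriv (deriv f) s =
      (1 - deriv f s ^ 2) * (1 - ((n : ℝ) - 1) * (Real.cosh s / Real.sinh s) * deriv f s)

/-- `g` is a positive solution of `g'' = (g'² - 1)((n-1) coth(g) - g')` on `(a, b)`, the equation of
the inverse functions of the solutions `f` above. -/
def SolvesInverseODE (n : ℕ) (a b : ℝ) (g : ℝ → ℝ) : Prop :=
  ContDiffOn ℝ ∞ g (Set.Ioo a b) ∧ (∀ t ∈ Set.Ioo a b, 0 < g t) ∧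
    ∀ t ∈ Set.Ioo a b, deriv (deriv g) t =
      (deriv g t ^ 2 - 1) * (((n : ℝ) - 1) * (Real.cosh (g t) / Real.sinh (g t)) - deriv g t)

/-- The profile of a spindle of radius `r`: a smooth curve `s = g(t)`, `a < t < b`, with its only
turning point at `(r, t₀)`, which is a bigraph: its lower part `a < t < t₀` is the graph of `f₊` and
its upper part `t₀ < t < b` is the graph of `f₋`, where `f₊, f₋ : (0, r) → ℝ` give graphical
time-like translators (`f₊' > 1`, `f₋' < -1`) whose slopes blow up at `r` and which reach the axis
`s = 0` with slopes `1` and `-1`. -/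
structure IsSpindleProfile (n : ℕ) (a t₀ b r : ℝ) (g fPlus fMinus : ℝ → ℝ) : Prop where
  lt_left : a < t₀
  lt_right : t₀ < b
  radius_pos : 0 < r
  inverse_ode : SolvesInverseODE n a b g
  turning_value : g t₀ = r
  turning_slope : deriv g t₀ = 0
  plus_ode : SolvesGraphODE n r fPlus
  plus_slope : ∀ s ∈ Set.Ioo 0 r, 1 < deriv fPlus s
  plus_inverse : ∀ s ∈ Set.Ioo 0 r, fPlus s ∈ Set.Ioo a t₀ ∧ g (fPlus s) = s
  plus_axis : Filter.Tendsto fPlus (𝓝[>] 0) (𝓝 a)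
  plus_axis_slope : Filter.Tendsto (deriv fPlus) (𝓝[>] 0) (𝓝 1)
  plus_turning : Filter.Tendsto fPlus (𝓝[<] r) (𝓝 t₀)
  plus_blowup : Filter.Tendsto (deriv fPlus) (𝓝[<] r) Filter.atTop
  minus_ode : SolvesGraphODE n r fMinus
  minus_slope : ∀ s ∈ Set.Ioo 0 r, deriv fMinus s < -1
  minus_inverse : ∀ s ∈ Set.Ioo 0 r, fMinus s ∈ Set.Ioo t₀ b ∧ g (fMinus s) = s
  minus_axis : Filter.Tendsto fMinus (𝓝[>] 0) (𝓝 b)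
  minus_axis_slope : Filter.Tendsto (deriv fMinus) (𝓝[>] 0) (𝓝 (-1))
  minus_turning : Filter.Tendsto fMinus (𝓝[<] r) (𝓝 t₀)
  minus_blowup : Filter.Tendsto (deriv fMinus) (𝓝[<] r) Filter.atBot

/-- The rotational hypersurface `{(p, t) | a < t < b, τ(p) = g(t)}` of `ℍⁿ ×₋₁ ℝ`. -/
def rotationalSet (n : ℕ) (a b : ℝ) (g : ℝ → ℝ) : Set (Ambient n) :=
  {q | q ∈ space n ∧ q.2.2 ∈ Set.Ioo a b ∧ tau q = g q.2.2}

/-- A spindle is the rotational hypersurface generated by a spindle profile. -/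
def IsSpindle (n : ℕ) (S : Set (Ambient n)) : Prop :=
  ∃ (a t₀ b r : ℝ) (g fPlus fMinus : ℝ → ℝ),
    IsSpindleProfile n a t₀ b r g fPlus fMinus ∧ S = rotationalSet n a b g

end HESU

end

/-! Write ρ = `pₙ₊₁` = cosh τ. A time-like tangent vector has nonzero `t`-component, because the
slices `t = const` are space-like; hence the height is a submersion. If ρ were independent of the
height somewhere, the image of (ρ, t) would contain an open set, and by rotation the projection of
the hypersurface to the coordinates (x, t) would too. This is impossible, as that projection has
Hausdorff dimension at most n in ℝⁿ⁺¹. So dρ vanishes on ker dt, and locally ρ = H(t)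
(`fderiv_eq_zero_of_rotationallyInvariant`, `ContDiffAt.exists_eventually_eq_comp`).

Pairing 𝐇 = (∂ₜ)^⊥ with the gradient of ρ - H(t) gives a second-order ODE for H
(`translator_equation`), and being time-like becomes H'² < H² - 1. The axis ρ = 1 is never met: the
induced metric would have rank at most one there. For H = cosh g the ODE is the equation of g, with
|g'| < 1.

That equation has a first integral. Put g' = tanh ω; then ω' = g' - (n-1) coth g. In the parameter μ
with dt = tanh(g) dμ, the quantity ω - g + (n-1)μ is constant, and it is normalized to 0. What
remains is s' = tanh(s) tanh(s - (n-1)μ), a bounded Lipschitz equation with global solutions. The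
angle ω is strictly decreasing with a zero, the only turning point; on both sides s tends to 0 while
t stays bounded. Every admissible initial condition thus lies on a spindle profile
(`exists_isSpindleProfile`).

Finally, uniqueness for the ODE and connectedness of `M` propagate ρ = cosh g(t) from one point to
the whole hypersurface: a limit point cannot lie at an end of the spindle, where ρ → 1
(`IsTimelikeHypersurface.exists_eq_cosh`). -/

noncomputable section

open Set Filter

/-! ### Tools from ODE theory and one-variable calculus. -/

theorem exists_global_solution {f : ℝ → ℝ → ℝ} {K L : NNReal} (hK : ∀ t, LipschitzWith K (f t))
    (hc : ∀ x, Continuous fun t => f t x) (hL : ∀ t x, ‖f t x‖ ≤ L) (t₀ x₀ : ℝ) :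
    ∃ α : ℝ → ℝ, α t₀ = x₀ ∧ ∀ t, HasDerivAt α (f t (α t)) t := by
  have key : ∀ R : NNReal, ∃ α : ℝ → ℝ, α t₀ = x₀ ∧
      ∀ t ∈ Ioo (t₀ - R) (t₀ + R), HasDerivAt α (f t (α t)) t := by
    intro R
    have h0 : t₀ ∈ Icc (t₀ - R) (t₀ + R) := by constructor <;> simp
    -- A field bounded by `L` moves a solution by at most `L * R` in time `R`, so with a ball of
    -- that radius the interval of existence is arbitrary. The solutions on different intervals are
    -- then glued by uniqueness.
    have hP : IsPicardLindelof f (⟨t₀, h0⟩ : Icc (t₀ - R) (t₀ + R)) x₀ (L * R) 0 L K :=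
      { lipschitzOnWith := fun t _ => (hK t).lipschitzOnWith
        continuousOn := fun x _ => (hc x).continuousOn
        norm_le := fun t _ x _ => hL t x
        mul_max_le := by simp }
    obtain ⟨α, h1, h2⟩ := hP.exists_eq_forall_mem_Icc_hasDerivWithinAt₀
    exact ⟨α, h1, fun t ht =>
      (h2 t (Ioo_subset_Icc_self ht)).hasDerivAt (Icc_mem_nhds ht.1 ht.2)⟩
  choose γ h1 h2 using key
  have agree : ∀ R R' : NNReal, 0 < R → R ≤ R' → EqOn (γ R) (γ R') (Ioo (t₀ - R) (t₀ + R)) := by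
    intro R R' hR hRR'
    have hRR : (R : ℝ) ≤ R' := hRR'
    have hR' : (0 : ℝ) < R := hR
    refine ODE_solution_unique_of_mem_Ioo (v := f) (s := fun _ => univ) (K := K) (t₀ := t₀)
      (fun t _ => (hK t).lipschitzOnWith) ⟨by linarith, by linarith⟩
      (fun t ht => ⟨h2 R t ht, trivial⟩)
      (fun t ht => ⟨h2 R' t ⟨by linarith [ht.1], by linarith [ht.2]⟩, trivial⟩) ?_
    rw [h1, h1]
  have mem : ∀ t : ℝ, ∀ R : NNReal, |t - t₀| < R → t ∈ Ioo (t₀ - R) (t₀ + R) := by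
    intro t R h
    rw [abs_lt] at h
    constructor <;> linarith
  let ρ : ℝ → NNReal := fun t => ⟨|t - t₀| + 1, by positivity⟩
  have hρ : ∀ t, (ρ t : ℝ) = |t - t₀| + 1 := fun t => rfl
  refine ⟨fun t => γ (ρ t) t, h1 _, fun t => ?_⟩
  let R : NNReal := ρ t + 1
  have hR : (R : ℝ) = |t - t₀| + 2 := by simp [R, hρ]; ring
  have hev : (fun t' => γ (ρ t') t') =ᶠ[𝓝 t] γ R := by
    have : ∀ᶠ t' in 𝓝 t, |t' - t₀| < |t - t₀| + 1 :=
      ContinuousAt.eventually_lt (by fun_prop) (by fun_prop) (by simp)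
    filter_upwards [this] with t' ht'
    refine agree (ρ t') R ?_ ?_ (mem _ _ ?_)
    · rw [← NNReal.coe_pos, hρ]; positivity
    · rw [← NNReal.coe_le_coe, hρ, hR]; linarith
    · rw [hρ]; linarith
  have hd := h2 R t (mem _ _ (by rw [hR]; linarith))
  have := hd.congr_of_eventuallyEq hev
  rwa [← hev.self_of_nhds] at this

theorem contDiff_of_hasDerivAt_of_contDiff {F : ℝ × ℝ → ℝ} (hF : ContDiff ℝ ∞ F) {s : ℝ → ℝ}
    (hs : ∀ t, HasDerivAt s (F (t, s t)) t) : ContDiff ℝ ∞ s := by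
  have hd : Differentiable ℝ s := fun t => (hs t).differentiableAt
  have hds : deriv s = fun t => F (t, s t) := funext fun t => (hs t).deriv
  rw [contDiff_infty]
  intro k
  induction k with
  | zero => exact contDiff_zero.2 hd.continuous
  | succ k ih =>
    rw [Nat.cast_succ, contDiff_succ_iff_deriv]
    refine ⟨hd, by simp, ?_⟩
    rw [hds]
    exact (hF.of_le (by exact_mod_cast le_top)).comp (contDiff_id.prodMk ih)

theorem exists_smooth_inverse {φ : ℝ → ℝ} {I : Set ℝ} (hI : IsOpen I)
    (hφ : ContDiffOn ℝ ∞ φ I) (hφ' : ∀ x ∈ I, deriv φ x ≠ 0) (hinj : InjOn φ I) :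
    ∃ ψ : ℝ → ℝ, (∀ y ∈ φ '' I, ψ y ∈ I ∧ φ (ψ y) = y) ∧ (∀ x ∈ I, ψ (φ x) = x) ∧
      ContDiffOn ℝ ∞ ψ (φ '' I) ∧ ∀ y ∈ φ '' I, HasDerivAt ψ (deriv φ (ψ y))⁻¹ y := by
  have h1 : ∀ y ∈ φ '' I, Function.invFunOn φ I y ∈ I ∧ φ (Function.invFunOn φ I y) = y :=
    fun y hy => ⟨Function.invFunOn_mem hy, Function.invFunOn_eq hy⟩
  have h2 : ∀ x ∈ I, Function.invFunOn φ I (φ x) = x := fun x hx =>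
    hinj (h1 _ (mem_image_of_mem φ hx)).1 hx (h1 _ (mem_image_of_mem φ hx)).2
  have key : ∀ x ∈ I, ContDiffAt ℝ ∞ (Function.invFunOn φ I) (φ x) ∧
      HasDerivAt (Function.invFunOn φ I) (deriv φ x)⁻¹ (φ x) := by
    intro x hx
    have hc : ContDiffAt ℝ ∞ φ x := hφ.contDiffAt (hI.mem_nhds hx)
    have hd : HasStrictDerivAt φ (deriv φ x) x := hc.hasStrictDerivAt (by simp)
    have hev : Function.invFunOn φ I =ᶠ[𝓝 (φ x)] hd.localInverse φ (deriv φ x) x (hφ' x hx) := by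
      have hg := hd.to_localInverse (hφ' x hx)
      have hgx : hd.localInverse φ (deriv φ x) x (hφ' x hx) (φ x) = x :=
        (hd.hasStrictFDerivAt_equiv (hφ' x hx)).localInverse_apply_image
      have e1 : ∀ᶠ y in 𝓝 (φ x), hd.localInverse φ (deriv φ x) x (hφ' x hx) y ∈ I := by
        apply hg.hasDerivAt.continuousAt
        rw [hgx]
        exact hI.mem_nhds hx
      have e2 : ∀ᶠ y in 𝓝 (φ x), φ (hd.localInverse φ (deriv φ x) x (hφ' x hx) y) = y :=
        (hd.hasStrictFDerivAt_equiv (hφ' x hx)).eventually_right_inverse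
      filter_upwards [e1, e2] with y hy1 hy2
      conv_lhs => rw [← hy2]
      exact h2 _ hy1
    constructor
    · refine ContDiffAt.congr_of_eventuallyEq ?_ hev
      exact hc.to_localInverse (f' := ContinuousLinearEquiv.unitsEquivAut ℝ
        (Units.mk0 _ (hφ' x hx))) (hd.hasStrictFDerivAt_equiv (hφ' x hx)).hasFDerivAt (by simp)
    · exact (hd.to_localInverse (hφ' x hx)).hasDerivAt.congr_of_eventuallyEq hev
  refine ⟨Function.invFunOn φ I, h1, h2, ?_, ?_⟩
  · rintro _ ⟨x, hx, rfl⟩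
    exact (key x hx).1.contDiffWithinAt
  · rintro _ ⟨x, hx, rfl⟩
    rw [h2 x hx]
    exact (key x hx).2

theorem StrictMonoOn.tendsto_rightInverse {g f : ℝ → ℝ} {p q c d : ℝ} (hpq : p < q)
    (hg : StrictMonoOn g (Ioo p q)) (hmaps : MapsTo g (Ioo p q) (Ioo c d))
    (hf : ∀ s ∈ Ioo c d, f s ∈ Ioo p q ∧ g (f s) = s) :
    Tendsto f (𝓝[>] c) (𝓝[>] p) ∧ Tendsto f (𝓝[<] d) (𝓝[<] q) := by
  have hm : (p + q) / 2 ∈ Ioo p q := ⟨by linarith, by linarith⟩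
  have hcd : c < d := (hmaps hm).1.trans (hmaps hm).2
  have hc : ∀ᶠ s in 𝓝[>] c, s ∈ Ioo c d := Ioo_mem_nhdsGT hcd
  have hd : ∀ᶠ s in 𝓝[<] d, s ∈ Ioo c d := Ioo_mem_nhdsLT hcd
  constructor
  · rw [tendsto_nhdsWithin_iff]
    refine ⟨tendsto_order.2 ⟨fun x hx => ?_, fun x hx => ?_⟩, ?_⟩
    · filter_upwards [hc] with s hs using hx.trans (hf s hs).1.1
    · have hy : min x ((p + q) / 2) ∈ Ioo p q :=
        ⟨lt_min hx hm.1, (min_le_right _ _).trans_lt hm.2⟩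
      filter_upwards [Ioo_mem_nhdsGT (hmaps hy).1, hc] with s hs hs'
      refine lt_of_lt_of_le ?_ (min_le_left x ((p + q) / 2))
      rw [← hg.lt_iff_lt (hf s hs').1 hy, (hf s hs').2]
      exact hs.2
    · filter_upwards [hc] with s hs using (hf s hs).1.1
  · rw [tendsto_nhdsWithin_iff]
    refine ⟨tendsto_order.2 ⟨fun x hx => ?_, fun x hx => ?_⟩, ?_⟩
    · have hy : max x ((p + q) / 2) ∈ Ioo p q :=
        ⟨hm.1.trans_le (le_max_right _ _), max_lt hx hm.2⟩
      filter_upwards [Ioo_mem_nhdsLT (hmaps hy).2, hd] with s hs hs'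
      refine lt_of_le_of_lt (le_max_left x ((p + q) / 2)) ?_
      rw [← hg.lt_iff_lt hy (hf s hs').1, (hf s hs').2]
      exact hs.1
    · filter_upwards [hd] with s hs using (hf s hs).1.2.trans hx
    · filter_upwards [hd] with s hs using (hf s hs).1.2

theorem StrictAntiOn.tendsto_rightInverse {g f : ℝ → ℝ} {p q c d : ℝ} (hpq : p < q)
    (hg : StrictAntiOn g (Ioo p q)) (hmaps : MapsTo g (Ioo p q) (Ioo c d))
    (hf : ∀ s ∈ Ioo c d, f s ∈ Ioo p q ∧ g (f s) = s) :
    Tendsto f (𝓝[>] c) (𝓝[<] q) ∧ Tendsto f (𝓝[<] d) (𝓝[>] p) := by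
  have hn : ∀ x ∈ Ioo (-q) (-p), -x ∈ Ioo p q := fun x hx => ⟨by linarith [hx.2], by linarith [hx.1]⟩
  obtain ⟨h1, h2⟩ := StrictMonoOn.tendsto_rightInverse (g := fun x => g (-x)) (f := fun s => -f s)
    (p := -q) (q := -p) (c := c) (d := d) (by linarith)
    (fun x hx y hy hxy => hg (hn y hy) (hn x hx) (neg_lt_neg hxy))
    (fun x hx => hmaps (hn x hx))
    (fun s hs => ⟨⟨by linarith [(hf s hs).1.2], by linarith [(hf s hs).1.1]⟩, by
      simpa using (hf s hs).2⟩)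
  constructor
  · simpa [Function.comp_def] using tendsto_neg_nhdsGT_neg.comp h1
  · simpa [Function.comp_def] using tendsto_neg_nhdsLT_neg.comp h2

theorem StrictMono.range_eq_Ioo {t : ℝ → ℝ} (ht : StrictMono t) (hc : Continuous t)
    (hb : BddAbove (range t)) (hb' : BddBelow (range t)) :
    range t = Ioo (⨅ x, t x) (⨆ x, t x) := by
  apply Subset.antisymm
  · rintro _ ⟨x, rfl⟩
    exact ⟨(ciInf_le hb' (x - 1)).trans_lt (ht (by linarith)),
      (ht (by linarith)).trans_le (le_ciSup hb (x + 1))⟩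
  · rintro y ⟨h1, h2⟩
    obtain ⟨u, hu⟩ := exists_lt_of_ciInf_lt h1
    obtain ⟨v, hv⟩ := exists_lt_of_lt_ciSup h2
    exact mem_range_of_exists_le_of_exists_ge hc ⟨u, hu.le⟩ ⟨v, hv.le⟩

/-! ### The hyperbolic tangent. -/

namespace Real

theorem contDiff_tanh {k : WithTop ℕ∞} : ContDiff ℝ k tanh := by
  rw [show tanh = fun x => sinh x / cosh x from funext tanh_eq_sinh_div_cosh]
  exact contDiff_sinh.div contDiff_cosh fun x => (cosh_pos x).ne'

theorem hasDerivAt_tanh (x : ℝ) : HasDerivAt tanh (1 - tanh x ^ 2) x := by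
  have h := ((hasDerivAt_sinh x).div (hasDerivAt_cosh x) (cosh_pos x).ne').congr_of_eventuallyEq
    (Eventually.of_forall tanh_eq_sinh_div_cosh)
  refine h.congr_deriv ?_
  have := (cosh_pos x).ne'
  rw [tanh_eq_sinh_div_cosh]
  field_simp

theorem lipschitzWith_tanh : LipschitzWith 1 tanh := by
  refine lipschitzWith_of_nnnorm_deriv_le (fun x => (hasDerivAt_tanh x).differentiableAt) fun x => ?_
  rw [(hasDerivAt_tanh x).deriv, ← NNReal.coe_le_coe, coe_nnnorm, NNReal.coe_one, norm_eq_abs,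
    abs_of_pos (by linarith [tanh_sq_lt_one x])]
  linarith [sq_nonneg (tanh x)]

theorem tanh_pos {x : ℝ} (hx : 0 < x) : 0 < tanh x := by
  rw [tanh_eq_sinh_div_cosh]
  exact div_pos (sinh_pos_iff.2 hx) (cosh_pos x)

theorem tanh_neg_of_neg {x : ℝ} (hx : x < 0) : tanh x < 0 := by
  rw [tanh_eq_sinh_div_cosh]
  exact div_neg_of_neg_of_pos (sinh_neg_iff.2 hx) (cosh_pos x)

theorem strictMono_tanh : StrictMono tanh :=
  strictMono_of_deriv_pos fun x => by
    rw [(hasDerivAt_tanh x).deriv]; linarith [tanh_sq_lt_one x]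

theorem tendsto_tanh_atTop : Tendsto tanh atTop (𝓝 1) := by
  refine tendsto_order.2 ⟨fun x hx => ?_, fun x hx => ?_⟩
  · have h0 : max x 0 ∈ Ioo (-1) 1 := ⟨by simp, by simp [hx]⟩
    filter_upwards [eventually_gt_atTop (artanh (max x 0))] with y hy
    calc x ≤ max x 0 := le_max_left _ _
      _ = tanh (artanh (max x 0)) := (tanh_artanh h0).symm
      _ < tanh y := strictMono_tanh hy
  · exact Eventually.of_forall fun y => (tanh_lt_one y).trans hx

theorem tendsto_tanh_atBot : Tendsto tanh atBot (𝓝 (-1)) := by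
  have := (tendsto_tanh_atTop.comp tendsto_neg_atBot_atTop).neg
  refine this.congr fun x => ?_
  simp [tanh_neg]

end Real

/-! ### The profile curve and its asymptotics. -/

theorem antitoneOn_Ici_of_hasDerivAt {f f' : ℝ → ℝ} {m : ℝ}
    (hf : ∀ x, m ≤ x → HasDerivAt f (f' x) x) (hf' : ∀ x, m ≤ x → f' x ≤ 0) :
    AntitoneOn f (Ici m) := by
  refine antitoneOn_of_deriv_nonpos (convex_Ici m) (HasDerivAt.continuousOn fun x hx => hf x hx)
    (fun x hx => ?_) fun x hx => ?_
  · rw [interior_Ici] at hx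
    exact (hf x (le_of_lt hx)).differentiableAt.differentiableWithinAt
  · rw [interior_Ici] at hx
    rw [(hf x (le_of_lt hx)).deriv]
    exact hf' x (le_of_lt hx)

/-- While `s ≥ ε` it decreases at rate at least `κ tanh ε`, which cannot last; and `s + κ t` is
nonincreasing with `s > 0`, which bounds `t`. This is why the profile reaches the axis at finite
height. -/
theorem tendsto_zero_and_bounded_of_deriv_le_neg_tanh {s s' t : ℝ → ℝ} {κ m : ℝ} (hκ : 0 < κ)
    (hpos : ∀ x, 0 < s x) (hs : ∀ x, m ≤ x → HasDerivAt s (s' x) x)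
    (hle : ∀ x, m ≤ x → s' x ≤ -κ * Real.tanh (s x))
    (ht : ∀ x, m ≤ x → HasDerivAt t (Real.tanh (s x)) x) :
    Tendsto s atTop (𝓝 0) ∧ ∃ B, ∀ x, m ≤ x → t x ≤ B := by
  have hanti : AntitoneOn s (Ici m) := antitoneOn_Ici_of_hasDerivAt hs fun x hx => by
    nlinarith [hle x hx, Real.tanh_pos (hpos x)]
  constructor
  · refine tendsto_order.2 ⟨fun y hy => Eventually.of_forall fun x => hy.trans (hpos x),
      fun ε hε => ?_⟩
    suffices h : ∃ x, m ≤ x ∧ s x < ε by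
      obtain ⟨x, hx, hxε⟩ := h
      filter_upwards [eventually_ge_atTop x] with y hy
      exact (hanti hx (mem_Ici.2 (hx.trans hy)) hy).trans_lt hxε
    by_contra! h
    have hδ : 0 < κ * Real.tanh ε := mul_pos hκ (Real.tanh_pos hε)
    have h2 : AntitoneOn (fun x => s x + κ * Real.tanh ε * x) (Ici m) := by
      refine antitoneOn_Ici_of_hasDerivAt
        (fun x hx => (hs x hx).add ((hasDerivAt_id x).const_mul (κ * Real.tanh ε))) fun x hx => ?_
      have h3 := Real.strictMono_tanh.monotone (h x hx)
      nlinarith [hle x hx, mul_le_mul_of_nonneg_left h3 hκ.le]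
    -- The time at which the linear upper bound for `s` reaches zero.
    have hx : m ≤ m + s m / (κ * Real.tanh ε) := by
      have := div_pos (hpos m) hδ
      linarith
    have h4 := h2 self_mem_Ici (mem_Ici.2 hx) hx
    have h5 : κ * Real.tanh ε * (s m / (κ * Real.tanh ε)) = s m := mul_div_cancel₀ _ hδ.ne'
    simp only [mul_add, h5] at h4
    linarith [hpos (m + s m / (κ * Real.tanh ε))]
  · have h2 : AntitoneOn (fun x => s x + κ * t x) (Ici m) :=
      antitoneOn_Ici_of_hasDerivAt
        (fun x hx => (hs x hx).add ((ht x hx).const_mul κ)) fun x hx => by linarith [hle x hx]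
    refine ⟨(s m + κ * t m) / κ, fun x hx => ?_⟩
    rw [le_div_iff₀ hκ]
    have := h2 self_mem_Ici (mem_Ici.2 hx) hx
    simp only at this
    linarith [hpos x]

/-- The profile curve of a spindle in a parameter for which its equation extends to a complete
vector field: `s` is the radius, `t` the height, and `tanh (s μ - c μ)` the slope `ds/dt`. -/
structure IsProfileCurve (c : ℝ) (s t : ℝ → ℝ) : Prop where
  smooth_radius : ContDiff ℝ ∞ s
  smooth_height : ContDiff ℝ ∞ t
  radius_pos : ∀ μ, 0 < s μ
  deriv_radius : ∀ μ, HasDerivAt s (Real.tanh (s μ) * Real.tanh (s μ - c * μ)) μ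
  deriv_height : ∀ μ, HasDerivAt t (Real.tanh (s μ)) μ

theorem exists_isProfileCurve {c : ℝ} (hc : 1 ≤ c) {s₁ v₁ : ℝ} (t₁ : ℝ) (hs₁ : 0 < s₁)
    (hv₁ : v₁ ∈ Ioo (-1) 1) :
    ∃ (s t : ℝ → ℝ) (μ₁ : ℝ), IsProfileCurve c s t ∧ s μ₁ = s₁ ∧ t μ₁ = t₁ ∧
      Real.tanh (s₁ - c * μ₁) = v₁ := by
  -- The equation depends on `μ`, so the initial slope is prescribed by the choice of the initial
  -- parameter: `s₁ - c μ₁ = artanh v₁`.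
  set μ₁ := (s₁ - Real.artanh v₁) / c with hμ₁
  have hcμ : s₁ - c * μ₁ = Real.artanh v₁ := by rw [hμ₁]; field_simp; ring
  have hbound : ∀ x, ‖Real.tanh x‖ ≤ 1 := fun x => (Real.abs_tanh_lt_one x).le
  have hlip : ∀ x y, |Real.tanh x - Real.tanh y| ≤ |x - y| := fun x y => by
    simpa [Real.dist_eq] using Real.lipschitzWith_tanh.dist_le_mul x y
  have hK : ∀ t, LipschitzWith 2 fun x => Real.tanh x * Real.tanh (x - c * t) := by
    refine fun t => LipschitzWith.of_dist_le_mul fun x y => ?_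
    rw [Real.dist_eq, Real.dist_eq]
    have h1 := hlip x y
    have h2 := hlip (x - c * t) (y - c * t)
    have e : Real.tanh x * Real.tanh (x - c * t) - Real.tanh y * Real.tanh (y - c * t) =
      (Real.tanh x - Real.tanh y) * Real.tanh (x - c * t) +
        Real.tanh y * (Real.tanh (x - c * t) - Real.tanh (y - c * t)) := by ring
    rw [e]
    refine (abs_add_le _ _).trans ?_
    rw [abs_mul, abs_mul]
    have h3 := hbound (x - c * t)
    have h4 := hbound y
    rw [Real.norm_eq_abs] at h3 h4
    rw [sub_sub_sub_cancel_right] at h2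
    have h5 := mul_le_mul h1 h3 (abs_nonneg _) (abs_nonneg _)
    have h6 := mul_le_mul h4 h2 (abs_nonneg _) zero_le_one
    push_cast
    linarith
  have hcont : Continuous Real.tanh := Real.contDiff_tanh.continuous (n := 0)
  have hsm : ContDiff ℝ ∞ Real.tanh := Real.contDiff_tanh
  obtain ⟨s, hs1, hs⟩ := exists_global_solution (L := 1) hK (fun x => by fun_prop) (fun t x => by
    rw [norm_mul, NNReal.coe_one]
    exact mul_le_one₀ (hbound _) (norm_nonneg _) (hbound _)) μ₁ s₁
  have hF : ContDiff ℝ ∞ fun p : ℝ × ℝ => Real.tanh p.2 * Real.tanh (p.2 - c * p.1) :=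
    (hsm.comp contDiff_snd).mul
      (hsm.comp (contDiff_snd.sub (contDiff_const.mul contDiff_fst)))
  have hss : ContDiff ℝ ∞ s := contDiff_of_hasDerivAt_of_contDiff hF hs
  -- The zero function solves the same equation, so a solution that vanishes once vanishes
  -- identically.
  have hne : ∀ μ, s μ ≠ 0 := by
    intro μ h0
    have := ODE_solution_unique_univ (v := fun t x => Real.tanh x * Real.tanh (x - c * t))
      (s := fun _ => univ) (K := 2) (f := s) (g := fun _ => 0) (t₀ := μ)
      (fun t => (hK t).lipschitzOnWith) (fun t => ⟨hs t, trivial⟩)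
      (fun t => ⟨by simpa using hasDerivAt_const t (0 : ℝ), trivial⟩) h0
    rw [this] at hs1
    exact hs₁.ne hs1
  have hpos : ∀ μ, 0 < s μ := by
    intro μ
    by_contra! h
    have : (0 : ℝ) ∈ range s :=
      mem_range_of_exists_le_of_exists_ge hss.continuous ⟨μ, h⟩ ⟨μ₁, hs1 ▸ hs₁.le⟩
    obtain ⟨x, hx⟩ := this
    exact hne x hx
  have hct : Continuous fun μ => Real.tanh (s μ) := hcont.comp hss.continuous
  have ht : ∀ μ, HasDerivAt (fun μ => t₁ + ∫ x in μ₁..μ, Real.tanh (s x)) (Real.tanh (s μ)) μ :=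
    fun μ => ((hct.integral_hasStrictDerivAt μ₁ μ).hasDerivAt).const_add t₁
  refine ⟨s, fun μ => t₁ + ∫ x in μ₁..μ, Real.tanh (s x), μ₁, ⟨hss, ?_, hpos, hs, ht⟩, hs1, ?_, ?_⟩
  · exact contDiff_of_hasDerivAt_of_contDiff (F := fun p => Real.tanh (s p.1))
      (hsm.comp (hss.comp contDiff_fst)) ht
  · simp
  · rw [hcμ, Real.tanh_artanh hv₁]

namespace IsProfileCurve

variable {c : ℝ} {s t : ℝ → ℝ}

theorem deriv_angle (h : IsProfileCurve c s t) (μ : ℝ) : HasDerivAt (fun μ => s μ - c * μ)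
    (Real.tanh (s μ) * Real.tanh (s μ - c * μ) - c) μ :=
  ((h.deriv_radius μ).sub ((hasDerivAt_id μ).const_mul c)).congr_deriv (by simp)

theorem strictAnti_angle (h : IsProfileCurve c s t) (hc : 1 ≤ c) :
    StrictAnti fun μ => s μ - c * μ :=
  strictAnti_of_deriv_neg fun μ => by
    rw [(h.deriv_angle μ).deriv]
    have h1 := Real.tanh_lt_one (s μ)
    have h2 := Real.abs_tanh_lt_one (s μ - c * μ)
    have h3 := Real.tanh_pos (h.radius_pos μ)
    rw [abs_lt] at h2
    nlinarith

theorem strictMono_height (h : IsProfileCurve c s t) : StrictMono t :=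
  strictMono_of_deriv_pos fun μ => by
    rw [(h.deriv_height μ).deriv]; exact Real.tanh_pos (h.radius_pos μ)

/-- The angle `ω` satisfies `ω' = tanh s tanh ω - c`. If it stayed positive, its slope after time 0
would be at most `tanh ω(0) - 1 < 0`; if it stayed negative, its slope would be at most `-1`
everywhere, which forces a sign change backwards in time. -/
theorem exists_angle_eq_zero (h : IsProfileCurve c s t) (hc : 1 ≤ c) : ∃ m, s m - c * m = 0 := by
  suffices (0 : ℝ) ∈ range fun μ => s μ - c * μ from this
  have hcont : Continuous fun μ => s μ - c * μ := by
    have := h.smooth_radius.continuous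
    fun_prop
  have hanti := h.strictAnti_angle hc
  refine mem_range_of_exists_le_of_exists_ge hcont ?_ ?_
  · by_contra! hpos
    set κ := 1 - Real.tanh (s 0 - c * 0) with hκ
    have hκ0 : 0 < κ := by linarith [Real.tanh_lt_one (s 0 - c * 0)]
    have hbd : AntitoneOn (fun μ => s μ - c * μ + κ * μ) (Ici 0) := by
      refine antitoneOn_Ici_of_hasDerivAt
        (fun x _ => (h.deriv_angle x).add ((hasDerivAt_id x).const_mul κ)) fun x hx => ?_
      have h1 := Real.tanh_lt_one (s x)
      have h2 := Real.tanh_pos (hpos x)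
      have h3 := Real.strictMono_tanh.monotone (hanti.antitone hx)
      nlinarith
    have hx : 0 ≤ (s 0 - c * 0) / κ := (div_pos (hpos 0) hκ0).le
    have h4 := hbd self_mem_Ici hx hx
    have h5 : κ * ((s 0 - c * 0) / κ) = s 0 - c * 0 := by field_simp
    simp only [h5] at h4
    linarith [hpos ((s 0 - c * 0) / κ)]
  · by_contra! hneg
    have hbd : Monotone fun μ => - (s μ - c * μ) - μ := by
      have hd := fun x => (h.deriv_angle x).fun_neg.fun_sub (hasDerivAt_id' x)
      refine monotone_of_deriv_nonneg (fun x => (hd x).differentiableAt) fun x => ?_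
      · rw [(hd x).deriv]
        have h1 := Real.tanh_pos (h.radius_pos x)
        have h2 := Real.tanh_neg_of_neg (hneg x)
        nlinarith
    have h0 := hneg 0
    have h4 := hbd h0.le
    simp only at h4
    have h5 := hneg (s 0 - c * 0)
    linarith

/-- From one unit past the zero of the angle, `tanh ω` is at most a negative constant, so the
comparison with `-κ tanh s` applies. -/
theorem tendsto_atTop (h : IsProfileCurve c s t) (hc : 1 ≤ c) :
    Tendsto s atTop (𝓝 0) ∧ BddAbove (range t) := by
  obtain ⟨m, hm⟩ := h.exists_angle_eq_zero hc
  have hanti := h.strictAnti_angle hc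
  have hneg : s (m + 1) - c * (m + 1) < 0 := by
    have := hanti (show m < m + 1 by linarith)
    simp only at this
    linarith
  obtain ⟨h1, B, hB⟩ := tendsto_zero_and_bounded_of_deriv_le_neg_tanh (m := m + 1)
    (neg_pos.2 (Real.tanh_neg_of_neg hneg)) h.radius_pos (fun x _ => h.deriv_radius x)
    (fun x hx => by
      rw [neg_neg, mul_comm]
      exact mul_le_mul_of_nonneg_right (Real.strictMono_tanh.monotone (hanti.antitone hx))
        (Real.tanh_pos (h.radius_pos x)).le) (fun x _ => h.deriv_height x)
  refine ⟨h1, B, ?_⟩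
  rintro _ ⟨x, rfl⟩
  exact (h.strictMono_height.monotone (le_max_left x (m + 1))).trans (hB _ (le_max_right _ _))

/-- The same comparison after reversing the parameter and the sign of the height. -/
theorem tendsto_atBot (h : IsProfileCurve c s t) (hc : 1 ≤ c) :
    Tendsto s atBot (𝓝 0) ∧ BddBelow (range t) := by
  obtain ⟨m, hm⟩ := h.exists_angle_eq_zero hc
  have hanti := h.strictAnti_angle hc
  have hpos : 0 < s (m - 1) - c * (m - 1) := by
    have := hanti (show m - 1 < m by linarith)
    simp only at this
    linarith
  obtain ⟨h1, B, hB⟩ := tendsto_zero_and_bounded_of_deriv_le_neg_tanh (m := -(m - 1))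
    (s := fun x => s (-x)) (t := fun x => -t (-x))
    (Real.tanh_pos hpos) (fun x => h.radius_pos _)
    (fun x _ => (h.deriv_radius (-x)).comp x (hasDerivAt_neg x))
    (fun x hx => by
      have h2 : Real.tanh (s (m - 1) - c * (m - 1)) ≤ Real.tanh (s (-x) - c * -x) :=
        Real.strictMono_tanh.monotone (hanti.antitone (show -x ≤ m - 1 by linarith))
      nlinarith [Real.tanh_pos (h.radius_pos (-x))])
    (fun x _ =>
      ((h.deriv_height (-x)).comp x (hasDerivAt_neg x)).neg.congr_deriv (by simp))
  constructor
  · simpa [Function.comp_def] using h1.comp tendsto_neg_atBot_atTop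
  · refine ⟨-B, ?_⟩
    rintro _ ⟨x, rfl⟩
    have h3 := hB (-(min x (m - 1))) (neg_le_neg (min_le_right _ _))
    rw [neg_neg] at h3
    linarith [h.strictMono_height.monotone (min_le_left x (m - 1))]

end IsProfileCurve

/-! ### From the profile curve to the spindle. -/

namespace HESU

/-- For the inverse function, `f' = 1/g'` and `f'' = -g''/g'³`, which exchanges the two equations.
-/
theorem exists_graph_of_inverse {n : ℕ} {g : ℝ → ℝ} {p q r : ℝ}
    (hg : ContDiffOn ℝ ∞ g (Ioo p q))
    (hode : ∀ t ∈ Ioo p q, deriv (deriv g) t =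
      (deriv g t ^ 2 - 1) * (((n : ℝ) - 1) * (Real.cosh (g t) / Real.sinh (g t)) - deriv g t))
    (hne : ∀ t ∈ Ioo p q, deriv g t ≠ 0) (hinj : InjOn g (Ioo p q))
    (him : g '' Ioo p q = Ioo 0 r) :
    ∃ f : ℝ → ℝ, SolvesGraphODE n r f ∧
      (∀ s ∈ Ioo 0 r, f s ∈ Ioo p q ∧ g (f s) = s) ∧
        ∀ s ∈ Ioo 0 r, deriv f s = (deriv g (f s))⁻¹ := by
  obtain ⟨f, h1, -, h3, h4⟩ := exists_smooth_inverse isOpen_Ioo hg hne hinj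
  rw [him] at h1 h3 h4
  have h5 : ∀ s ∈ Ioo 0 r, deriv f s = (deriv g (f s))⁻¹ := fun s hs => (h4 s hs).deriv
  refine ⟨f, ⟨h3, fun s hs => ?_⟩, h1, h5⟩
  have hev : deriv f =ᶠ[𝓝 s] fun s => (deriv g (f s))⁻¹ := by
    filter_upwards [isOpen_Ioo.mem_nhds hs] with x hx using h5 x hx
  obtain ⟨hfs, hgf⟩ := h1 s hs
  have hdg : HasDerivAt (deriv g) (deriv (deriv g) (f s)) (f s) :=
    ((((contDiffOn_infty_iff_deriv_of_isOpen isOpen_Ioo).1 hg).2.differentiableOn (by simp)).differentiableAt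
      (isOpen_Ioo.mem_nhds hfs)).hasDerivAt
  have hw := hne _ hfs
  rw [hev.deriv_eq, (HasDerivAt.fun_inv (c := fun s => deriv g (f s)) (hdg.comp s (h4 s hs)) hw).deriv, h5 s hs, hode _ hfs]
  simp only [hgf]
  field_simp
  ring

/-- The height is strictly increasing and bounded, so it can serve as parameter: `ν` inverts `t`,
and `g = s ∘ ν` has slope `tanh ω`. -/
theorem _root_.IsProfileCurve.exists_inverse_solution {n : ℕ} (hn : 2 ≤ n) {s t : ℝ → ℝ}
    (h : IsProfileCurve ((n : ℝ) - 1) s t) :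
    ∃ (a b : ℝ) (g ν : ℝ → ℝ), (∀ μ, t μ ∈ Ioo a b ∧ ν (t μ) = μ) ∧
      (∀ y ∈ Ioo a b, t (ν y) = y) ∧ StrictMonoOn ν (Ioo a b) ∧ (∀ μ, g (t μ) = s μ) ∧
      (∀ μ, deriv g (t μ) = Real.tanh (s μ - ((n : ℝ) - 1) * μ)) ∧ SolvesInverseODE n a b g ∧
      Tendsto ν (𝓝[>] a) atBot ∧ Tendsto ν (𝓝[<] b) atTop ∧
      Tendsto g (𝓝[>] a) (𝓝 0) ∧ Tendsto g (𝓝[<] b) (𝓝 0) := by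
  have hc : (1 : ℝ) ≤ (n : ℝ) - 1 := by
    have : (2 : ℝ) ≤ n := by exact_mod_cast hn
    linarith
  set c : ℝ := (n : ℝ) - 1
  have htd : ∀ μ, deriv t μ = Real.tanh (s μ) := fun μ => (h.deriv_height μ).deriv
  have htanh : ∀ μ, Real.tanh (s μ) ≠ 0 := fun μ => (Real.tanh_pos (h.radius_pos μ)).ne'
  have hmono := h.strictMono_height
  have hrange := hmono.range_eq_Ioo h.smooth_height.continuous (h.tendsto_atTop hc).2
    (h.tendsto_atBot hc).2
  obtain ⟨ν, h1, h2, h3, h4⟩ := exists_smooth_inverse isOpen_univ h.smooth_height.contDiffOn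
    (fun μ _ => by rw [htd]; exact htanh μ) hmono.injective.injOn
  rw [image_univ, hrange] at h1 h3 h4
  set a := ⨅ x, t x
  set b := ⨆ x, t x
  have hmem : ∀ μ, t μ ∈ Ioo a b := fun μ => hrange ▸ mem_range_self μ
  have hνt : ∀ μ, ν (t μ) = μ := fun μ => h2 μ trivial
  have hνmono : StrictMonoOn ν (Ioo a b) := by
    intro x hx y hy hxy
    rw [← hmono.lt_iff_lt, (h1 x hx).2, (h1 y hy).2]
    exact hxy
  have hgd : ∀ y ∈ Ioo a b, HasDerivAt (s ∘ ν) (Real.tanh (s (ν y) - c * ν y)) y := by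
    intro y hy
    refine ((h.deriv_radius (ν y)).comp y (h4 y hy)).congr_deriv ?_
    rw [htd]
    have := htanh (ν y)
    field_simp
  have hbot : Tendsto ν (𝓝[>] a) atBot := by
    refine tendsto_atBot.2 fun M => ?_
    filter_upwards [Ioo_mem_nhdsGT (hmem M).1] with y hy
    have := hνmono ⟨hy.1, hy.2.trans (hmem M).2⟩ (hmem M) hy.2
    rw [hνt] at this
    exact this.le
  have htop : Tendsto ν (𝓝[<] b) atTop := by
    refine tendsto_atTop.2 fun M => ?_
    filter_upwards [Ioo_mem_nhdsLT (hmem M).2] with y hy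
    have := hνmono (hmem M) ⟨(hmem M).1.trans hy.1, hy.2⟩ hy.1
    rw [hνt] at this
    exact this.le
  refine ⟨a, b, s ∘ ν, ν, fun μ => ⟨hmem μ, hνt μ⟩, fun y hy => (h1 y hy).2, hνmono,
    fun μ => by simp [hνt], fun μ => ?_, ⟨?_, fun y hy => h.radius_pos _, fun y hy => ?_⟩,
    hbot, htop, (h.tendsto_atBot hc).1.comp hbot, (h.tendsto_atTop hc).1.comp htop⟩
  · rw [(hgd _ (hmem μ)).deriv, hνt]
  · exact h.smooth_radius.comp_contDiffOn h3
  · have hev : deriv (s ∘ ν) =ᶠ[𝓝 y] fun y => Real.tanh (s (ν y) - c * ν y) := by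
      filter_upwards [isOpen_Ioo.mem_nhds hy] with x hx using (hgd x hx).deriv
    have hd : HasDerivAt (fun y => Real.tanh (s (ν y) - c * ν y)) _ y :=
      (Real.hasDerivAt_tanh (s (ν y) - c * ν y)).comp (h := fun y => s (ν y) - c * ν y) y
        ((h.deriv_angle (ν y)).comp y (h4 y hy))
    rw [hev.deriv_eq, hd.deriv, (hgd y hy).deriv, htd, Function.comp_apply]
    have e : Real.cosh (s (ν y)) / Real.sinh (s (ν y)) = (Real.tanh (s (ν y)))⁻¹ := by
      rw [Real.tanh_eq_sinh_div_cosh, inv_div]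
    rw [e]
    have := htanh (ν y)
    field_simp
    ring

/-- The turning point is the zero `m` of the angle, with `t₀ = t m` and `r = s m`. The sign of the
angle splits `g` into two monotone branches, inverted by `fPlus` and `fMinus`; `|tanh| < 1` gives
their slope bounds. -/
theorem exists_isSpindleProfile {n : ℕ} (hn : 2 ≤ n) {s₁ v₁ : ℝ} (t₁ : ℝ) (hs₁ : 0 < s₁)
    (hv₁ : v₁ ∈ Ioo (-1) 1) :
    ∃ (a t₀ b r : ℝ) (g fPlus fMinus : ℝ → ℝ), IsSpindleProfile n a t₀ b r g fPlus fMinus ∧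
      t₁ ∈ Ioo a b ∧ g t₁ = s₁ ∧ deriv g t₁ = v₁ ∧
      Tendsto g (𝓝[>] a) (𝓝 0) ∧ Tendsto g (𝓝[<] b) (𝓝 0) := by
  have hc : (1 : ℝ) ≤ (n : ℝ) - 1 := by
    have : (2 : ℝ) ≤ n := by exact_mod_cast hn
    linarith
  obtain ⟨s, t, μ₁, h, hsμ, htμ, hω⟩ := exists_isProfileCurve hc t₁ hs₁ hv₁
  obtain ⟨m, hm⟩ := h.exists_angle_eq_zero hc
  obtain ⟨a, b, g, ν, hmem, hν, hνmono, hgs, hgt, hode, hνa, hνb, hga, hgb⟩ :=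
    h.exists_inverse_solution hn
  have hanti := h.strictAnti_angle hc
  have hal : a < t m := (hmem m).1.1
  have hbl : t m < b := (hmem m).1.2
  have hgder : ∀ y ∈ Ioo a b, deriv g y = Real.tanh (s (ν y) - ((n : ℝ) - 1) * ν y) := by
    intro y hy
    rw [← hgt, hν y hy]
  have hcont : ContinuousOn g (Ioo a b) := hode.1.continuousOn
  have hderlim : ∀ l : Filter ℝ, ∀ x, (∀ᶠ y in l, y ∈ Ioo a b) →
      Tendsto (fun y => Real.tanh (s (ν y) - ((n : ℝ) - 1) * ν y)) l x → Tendsto (deriv g) l x := by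
    intro l x hl hx
    refine hx.congr' ?_
    filter_upwards [hl] with y hy using (hgder y hy).symm
  have hposder : ∀ y ∈ Ioo a (t m), 0 < deriv g y := by
    intro y hy
    have hy' : y ∈ Ioo a b := ⟨hy.1, hy.2.trans hbl⟩
    rw [hgder y hy']
    apply Real.tanh_pos
    have h1 := hνmono hy' (hmem m).1 hy.2
    rw [(hmem m).2] at h1
    have h2 := hanti h1
    simp only at h2
    linarith
  have hnegder : ∀ y ∈ Ioo (t m) b, deriv g y < 0 := by
    intro y hy
    have hy' : y ∈ Ioo a b := ⟨hal.trans hy.1, hy.2⟩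
    rw [hgder y hy']
    apply Real.tanh_neg_of_neg
    have h1 := hνmono (hmem m).1 hy' hy.1
    rw [(hmem m).2] at h1
    have h2 := hanti h1
    simp only at h2
    linarith
  have hderlt : ∀ y ∈ Ioo a b, deriv g y < 1 ∧ -1 < deriv g y := fun y hy => by
    rw [hgder y hy]; exact ⟨Real.tanh_lt_one _, Real.neg_one_lt_tanh _⟩
  have hsubl : Ioo a (t m) ⊆ Ioo a b := Ioo_subset_Ioo_right hbl.le
  have hsubr : Ioo (t m) b ⊆ Ioo a b := Ioo_subset_Ioo_left hal.le
  have hmonoC : StrictMonoOn g (Ioc a (t m)) := by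
    refine strictMonoOn_of_deriv_pos (convex_Ioc _ _)
      (hcont.mono fun y hy => ⟨hy.1, hy.2.trans_lt hbl⟩) ?_
    rw [interior_Ioc]
    exact hposder
  have hantiC : StrictAntiOn g (Ico (t m) b) := by
    refine strictAntiOn_of_deriv_neg (convex_Ico _ _)
      (hcont.mono fun y hy => ⟨hal.trans_le hy.1, hy.2⟩) ?_
    rw [interior_Ico]
    exact hnegder
  have hmono := hmonoC.mono (Ioo_subset_Ioc_self)
  have hanti' := hantiC.mono (Ioo_subset_Ico_self)
  have hmapsl : MapsTo g (Ioo a (t m)) (Ioo 0 (s m)) := fun y hy =>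
    ⟨hode.2.1 y (hsubl hy), by
      rw [← hgs]; exact hmonoC ⟨hy.1, hy.2.le⟩ (right_mem_Ioc.2 hal) hy.2⟩
  have hmapsr : MapsTo g (Ioo (t m) b) (Ioo 0 (s m)) := fun y hy =>
    ⟨hode.2.1 y (hsubr hy), by
      rw [← hgs]; exact hantiC (left_mem_Ico.2 hbl) ⟨hy.1.le, hy.2⟩ hy.1⟩
  have himl : g '' Ioo a (t m) = Ioo 0 (s m) := by
    refine Subset.antisymm hmapsl.image_subset fun x hx => ?_
    obtain ⟨y, hy, hyx⟩ := (Filter.Eventually.and (Ioo_mem_nhdsGT hal)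
      (hga.eventually_lt_const hx.1)).exists
    obtain ⟨z, hz, hzx⟩ := intermediate_value_Ioo hy.2.le
      (hcont.mono fun z hz => ⟨hy.1.trans_le hz.1, hz.2.trans_lt hbl⟩) ⟨hyx, (hgs m).symm ▸ hx.2⟩
    exact ⟨z, ⟨hy.1.trans hz.1, hz.2⟩, hzx⟩
  have himr : g '' Ioo (t m) b = Ioo 0 (s m) := by
    refine Subset.antisymm hmapsr.image_subset fun x hx => ?_
    obtain ⟨y, hy, hyx⟩ := (Filter.Eventually.and (Ioo_mem_nhdsLT hbl)
      (hgb.eventually_lt_const hx.1)).exists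
    obtain ⟨z, hz, hzx⟩ := intermediate_value_Ioo' hy.1.le
      (hcont.mono fun z hz => ⟨hal.trans_le hz.1, hz.2.trans_lt hy.2⟩) ⟨hyx, (hgs m).symm ▸ hx.2⟩
    exact ⟨z, ⟨hz.1, hz.2.trans hy.2⟩, hzx⟩
  obtain ⟨fP, hP1, hP2, hP3⟩ := exists_graph_of_inverse (hode.1.mono hsubl)
    (fun y hy => hode.2.2 y (hsubl hy)) (fun y hy => (hposder y hy).ne') hmono.injOn himl
  obtain ⟨fM, hM1, hM2, hM3⟩ := exists_graph_of_inverse (hode.1.mono hsubr)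
    (fun y hy => hode.2.2 y (hsubr hy)) (fun y hy => (hnegder y hy).ne) hanti'.injOn himr
  obtain ⟨hPa, hPt⟩ := hmono.tendsto_rightInverse hal hmapsl hP2
  obtain ⟨hMb, hMt⟩ := hanti'.tendsto_rightInverse hbl hmapsr hM2
  have hr : 0 < s m := h.radius_pos m
  have h0 : ∀ᶠ x in 𝓝[>] (0 : ℝ), x ∈ Ioo 0 (s m) := Ioo_mem_nhdsGT hr
  have hrr : ∀ᶠ x in 𝓝[<] (s m), x ∈ Ioo 0 (s m) := Ioo_mem_nhdsLT hr
  have hab : a < b := hal.trans hbl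
  have hder0 : Tendsto (deriv g) (𝓝 (t m)) (𝓝 0) := by
    have h1 : ContinuousOn (deriv g) (Ioo a b) :=
      (hode.1.deriv_of_isOpen (m := 0) isOpen_Ioo (by simp)).continuousOn
    have h2 := (h1.continuousAt (isOpen_Ioo.mem_nhds (hmem m).1)).tendsto
    rwa [hgt, hm, Real.tanh_zero] at h2
  -- At the lower end `ν → -∞`, and `ω = s - (n-1)ν ≥ -ν` once `ν ≤ 0`, so `ω → ∞`. At the upper end
  -- `ω ≤ s m - ν → -∞`.
  have hda : Tendsto (deriv g) (𝓝[>] a) (𝓝 1) := by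
    refine hderlim _ _ (Ioo_mem_nhdsGT hab) (Real.tendsto_tanh_atTop.comp ?_)
    refine tendsto_atTop_mono' _ ?_ (tendsto_neg_atBot_atTop.comp hνa)
    filter_upwards [hνa.eventually_le_atBot 0] with y hy
    have := h.radius_pos (ν y)
    simp only [Function.comp_apply]
    nlinarith
  have hdb : Tendsto (deriv g) (𝓝[<] b) (𝓝 (-1)) := by
    refine hderlim _ _ (Ioo_mem_nhdsLT hab) (Real.tendsto_tanh_atBot.comp ?_)
    have hlim : Tendsto (fun y => s m - ν y) (𝓝[<] b) atBot :=
      tendsto_atBot_add_const_left _ _ (tendsto_neg_atTop_atBot.comp hνb)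
    refine tendsto_atBot_mono' _ ?_ hlim
    filter_upwards [hνb.eventually_ge_atTop 0, Ioo_mem_nhdsLT hbl] with y hy hy'
    have h1 := (hmapsr hy').2
    have h2 := hgs (ν y)
    rw [hν y (hsubr hy')] at h2
    nlinarith
  refine ⟨a, t m, b, s m, g, fP, fM, ?_, htμ ▸ (hmem μ₁).1, by rw [← htμ, hgs, hsμ],
    by rw [← htμ, hgt, hsμ, hω], hga, hgb⟩
  exact
    { lt_left := hal
      lt_right := hbl
      radius_pos := hr
      inverse_ode := hode
      turning_value := hgs m
      turning_slope := by rw [hgt, hm, Real.tanh_zero]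
      plus_ode := hP1
      plus_slope := fun x hx => by
        rw [hP3 x hx]
        exact (one_lt_inv₀ (hposder _ (hP2 x hx).1)).2 (hderlt _ (hsubl (hP2 x hx).1)).1
      plus_inverse := hP2
      plus_axis := hPa.mono_right nhdsWithin_le_nhds
      plus_axis_slope := by
        have h1 := (hda.comp hPa).inv₀ one_ne_zero
        rw [inv_one] at h1
        refine h1.congr' ?_
        filter_upwards [h0] with x hx using (hP3 x hx).symm
      plus_turning := hPt.mono_right nhdsWithin_le_nhds
      plus_blowup := by
        have h1 : Tendsto (fun x => deriv g (fP x)) (𝓝[<] (s m)) (𝓝[>] 0) := by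
          refine tendsto_nhdsWithin_iff.2
            ⟨hder0.comp (hPt.mono_right nhdsWithin_le_nhds), ?_⟩
          filter_upwards [hrr] with x hx using hposder _ (hP2 x hx).1
        refine h1.inv_tendsto_nhdsGT_zero.congr' ?_
        filter_upwards [hrr] with x hx using (hP3 x hx).symm
      minus_ode := hM1
      minus_slope := fun x hx => by
        rw [hM3 x hx]
        have h1 := hnegder _ (hM2 x hx).1
        have h2 := (hderlt _ (hsubr (hM2 x hx).1)).2
        have h3 : 1 < (-deriv g (fM x))⁻¹ :=
          (one_lt_inv₀ (by linarith)).2 (by linarith)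
        rw [inv_neg] at h3
        linarith
      minus_inverse := hM2
      minus_axis := hMb.mono_right nhdsWithin_le_nhds
      minus_axis_slope := by
        have h1 := (hdb.comp hMb).inv₀ (by norm_num)
        rw [inv_neg, inv_one] at h1
        refine h1.congr' ?_
        filter_upwards [h0] with x hx using (hM3 x hx).symm
      minus_turning := hMt.mono_right nhdsWithin_le_nhds
      minus_blowup := by
        have h1 : Tendsto (fun x => deriv g (fM x)) (𝓝[<] (s m)) (𝓝[<] 0) := by
          refine tendsto_nhdsWithin_iff.2
            ⟨hder0.comp (hMt.mono_right nhdsWithin_le_nhds), ?_⟩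
          filter_upwards [hrr] with x hx using hnegder _ (hM2 x hx).1
        refine h1.inv_tendsto_nhdsLT_zero.congr' ?_
        filter_upwards [hrr] with x hx using (hM3 x hx).symm }

/-! ### Linear algebra at a point and the translator equation. -/

variable {n : ℕ}

/-- `metric` as a bilinear map. -/
def metricForm (n : ℕ) : Ambient n →ₗ[ℝ] Ambient n →ₗ[ℝ] ℝ :=
  LinearMap.mk₂ ℝ metric
    (fun u v w => by simp only [metric, Prod.fst_add, Prod.snd_add, inner_add_left]; ring)
    (fun c v w => by
      simp only [metric, Prod.smul_fst, Prod.smul_snd, inner_smul_left, smul_eq_mul]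
      simp; ring)
    (fun u v w => by simp only [metric, Prod.fst_add, Prod.snd_add, inner_add_right]; ring)
    (fun c v w => by
      simp only [metric, Prod.smul_fst, Prod.smul_snd, inner_smul_right, smul_eq_mul]; ring)

theorem metricForm_apply (v w : Ambient n) : metricForm n v w = metric v w := rfl

theorem metric_comm (v w : Ambient n) : metric v w = metric w v := by
  simp only [metric, real_inner_comm]; ring

/-- The `metric`-gradient of the function `ρ - H t`, where `h = H' t`. -/
def levelGradient (n : ℕ) (h : ℝ) : Ambient n := (0, -1, h)

theorem metric_levelGradient (h : ℝ) (w : Ambient n) :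
    metric w (levelGradient n h) = w.2.1 - h * w.2.2 := by
  simp only [metric, levelGradient, inner_zero_right]; ring

theorem metric_levelGradient_self (h : ℝ) :
    metric (levelGradient n h) (levelGradient n h) = -1 - h ^ 2 := by
  rw [metric_levelGradient]; simp only [levelGradient]; ring

theorem metric_levelGradient_position (h : ℝ) (q : Ambient n) :
    metric (levelGradient n h) (position q) = q.2.1 := by
  rw [metric_comm, metric_levelGradient]; simp [position]

theorem metric_position_self {q : Ambient n} (hq : q ∈ space n) :
    metric (position q) (position q) = -1 := by
  have := hq.1
  simp only [metric, position]
  linarith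

theorem metric_timeVector (w : Ambient n) : metric (timeVector n) w = -w.2.2 := by
  simp [metric, timeVector]

section Pointwise

variable {e : Fin n → Ambient n} {q : Ambient n} {h : ℝ} {G : Matrix (Fin n) (Fin n) ℝ}

/-- Cauchy–Schwarz for `v.1` and `q.1`, with `v ⊥ χ`, bounds the hyperbolic part of `⟨v, v⟩` below
by `v.2.1² / (ρ² - 1)`. -/
theorem discriminant_pos_of_timelike {v : Ambient n} (hq : q ∈ space n) (hy : 1 < q.2.1)
    (hv : v.2.1 = h * v.2.2) (hvq : metric v (position q) = 0) (hvv : metric v v < 0) :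
    0 < q.2.1 ^ 2 - 1 - h ^ 2 := by
  have hcs := real_inner_mul_inner_self_le v.1 q.1
  have hq1 := hq.1
  simp only [metric, position] at hvq hvv
  set A := inner ℝ v.1 v.1
  set B := inner ℝ q.1 q.1
  set C := inner ℝ v.1 q.1
  have hC : C = v.2.1 * q.2.1 := by linarith
  have hB : B = q.2.1 ^ 2 - 1 := by linarith
  rw [hC, hB] at hcs
  have hy2 : 0 < q.2.1 ^ 2 - 1 := by nlinarith
  by_contra! hD
  have h1 : (q.2.1 ^ 2 - 1) * v.2.2 ^ 2 ≤ v.2.1 ^ 2 := by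
    rw [hv]; nlinarith [sq_nonneg v.2.2]
  nlinarith

theorem timeComponent_ne_zero_of_timelike {v : Ambient n} (hq : q ∈ space n)
    (hvq : metric v (position q) = 0) (hvv : metric v v < 0) : v.2.2 ≠ 0 := by
  intro h0
  have hcs := real_inner_mul_inner_self_le v.1 q.1
  have hq1 := hq.1
  have hA : 0 ≤ inner ℝ v.1 v.1 := real_inner_self_nonneg
  simp only [metric, position, h0] at hvq hvv
  set A := inner ℝ v.1 v.1
  set B := inner ℝ q.1 q.1
  set C := inner ℝ v.1 q.1
  have hC : C = v.2.1 * q.2.1 := by linarith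
  have hB : B = q.2.1 ^ 2 - 1 := by linarith
  rw [hC, hB] at hcs
  have hy2 := hq.2
  nlinarith [mul_pos hy2 hy2]

/-- Raising an index: this is the tangent vector with prescribed products with the frame. -/
theorem metric_inverse_sum (hG : ∀ i j, G i j = metric (e i) (e j)) (hdet : G.det ≠ 0)
    (c : Fin n → ℝ) (k : Fin n) :
    metric (∑ i, ∑ j, (G⁻¹ i j * c i) • e j) (e k) = c k := by
  have hinv : G⁻¹ * G = 1 := Matrix.nonsing_inv_mul G (isUnit_iff_ne_zero.2 hdet)
  rw [← metricForm_apply]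
  simp only [map_sum, map_smul, LinearMap.sum_apply, LinearMap.smul_apply, metricForm_apply,
    smul_eq_mul, ← hG]
  have : ∀ i, ∑ j, G⁻¹ i j * c i * G j k = c i * (G⁻¹ * G) i k := by
    intro i
    rw [Matrix.mul_apply, Finset.mul_sum]
    exact Finset.sum_congr rfl fun j _ => by ring
  simp only [this, hinv, Matrix.one_apply, mul_ite, mul_one, mul_zero, Finset.sum_ite_eq',
    Finset.mem_univ, if_true]

theorem metric_sum_of_forall (c : Fin n → Fin n → ℝ) {w : Ambient n}
    (hw : ∀ i, metric (e i) w = 0) : metric (∑ i, ∑ j, c i j • e j) w = 0 := by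
  rw [← metricForm_apply]
  simp [LinearMap.sum_apply, metricForm_apply, hw]

/-- The normal line is spanned by the gradient made orthogonal to `χ`; since `⟨χ, χ⟩ = -1`, this is
`levelGradient + ρ χ`, whose product with the gradient is `ρ² - 1 - h²`. -/
theorem eq_smul_normal (hG : ∀ i j, G i j = metric (e i) (e j)) (hdet : G.det ≠ 0)
    (hq : q ∈ space n) (heq : ∀ i, metric (e i) (position q) = 0)
    (heN : ∀ i, metric (e i) (levelGradient n h) = 0) (hD : q.2.1 ^ 2 - 1 - h ^ 2 ≠ 0)
    {w : Ambient n} (hwe : ∀ i, metric w (e i) = 0) (hwq : metric w (position q) = 0) :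
    w = (metric w (levelGradient n h) / (q.2.1 ^ 2 - 1 - h ^ 2)) •
      (levelGradient n h + q.2.1 • position q) := by
  set N : Ambient n := levelGradient n h + q.2.1 • position q with hN
  have hNe : ∀ i, metric N (e i) = 0 := fun i => by
    rw [← metricForm_apply, hN]
    simp [metricForm_apply, metric_comm _ (e i), heq, heN]
  have hNq : metric N (position q) = 0 := by
    rw [← metricForm_apply, hN]
    simp [metricForm_apply, metric_levelGradient_position, metric_position_self hq]
  have hNN : metric N (levelGradient n h) = q.2.1 ^ 2 - 1 - h ^ 2 := by
    rw [← metricForm_apply, hN]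
    simp only [map_add, map_smul, LinearMap.add_apply, LinearMap.smul_apply, metricForm_apply,
      metric_levelGradient_self, metric_comm (position q), metric_levelGradient_position,
      smul_eq_mul]
    ring
  let Θ : Ambient n →ₗ[ℝ] (Fin n → ℝ) × ℝ × ℝ :=
    (LinearMap.pi fun i => (metricForm n).flip (e i)).prod
      (((metricForm n).flip (position q)).prod ((metricForm n).flip (levelGradient n h)))
  have hΘ : ∀ v, Θ v = (fun i => metric v (e i), metric v (position q),
    metric v (levelGradient n h)) := fun v => rfl
  -- The frame, `χ` and `N` realize all values of the `n + 2` functionals; equality of dimensions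
  -- then makes `Θ` injective.
  have hsurj : Function.Surjective Θ := by
    rintro ⟨a, b, c⟩
    refine ⟨(∑ i, ∑ j, (G⁻¹ i j * a i) • e j) - b • position q +
      ((c + b * q.2.1) / (q.2.1 ^ 2 - 1 - h ^ 2)) • N, ?_⟩
    have h1 : Θ (∑ i, ∑ j, (G⁻¹ i j * a i) • e j) = (a, 0, 0) := by
      rw [hΘ, metric_sum_of_forall _ heq, metric_sum_of_forall _ heN]
      congr 1
      funext k
      exact metric_inverse_sum hG hdet a k
    have h2 : Θ (position q) = (0, -1, q.2.1) := by
      rw [hΘ, metric_position_self hq, metric_comm _ (levelGradient n h),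
        metric_levelGradient_position]
      congr 1
      funext k
      rw [metric_comm]; exact heq k
    have h3 : Θ N = (0, 0, q.2.1 ^ 2 - 1 - h ^ 2) := by
      rw [hΘ, hNq, hNN]
      congr 1
      funext k
      exact hNe k
    rw [map_add, map_sub, map_smul, map_smul, h1, h2, h3]
    ext k
    · simp
    · simp
    · simp only [Prod.snd_add, Prod.snd_sub, Prod.smul_snd, smul_eq_mul]
      field_simp
      ring
  have hinj : Function.Injective Θ := by
    refine (LinearMap.injective_iff_surjective_of_finrank_eq_finrank ?_).2 hsurj
    simp [Ambient]
  apply hinj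
  rw [map_smul, hΘ, hΘ]
  simp only [hwe, hwq, hNe, hNq, hNN, Prod.smul_mk, smul_eq_mul, mul_zero]
  rw [div_mul_cancel₀ _ hD]
  congr 1
  funext k
  simp

/-- The sum is the `t`-component of `u`, minus the tangential part of `∂ₜ`. So `∂ₜ + u` is normal,
and `eq_smul_normal` computes it. -/
theorem sum_inverse_mul_time (hG : ∀ i j, G i j = metric (e i) (e j)) (hdet : G.det ≠ 0)
    (hq : q ∈ space n) (heq : ∀ i, metric (e i) (position q) = 0)
    (heN : ∀ i, metric (e i) (levelGradient n h) = 0) (hD : q.2.1 ^ 2 - 1 - h ^ 2 ≠ 0) :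
    (∑ i, ∑ j, G⁻¹ i j * ((e i).2.2 * (e j).2.2)) * (q.2.1 ^ 2 - 1 - h ^ 2) =
      -(q.2.1 ^ 2 - 1) := by
  set u : Ambient n := ∑ i, ∑ j, (G⁻¹ i j * (e i).2.2) • e j with hu
  have h1 : ∀ k, metric (timeVector n + u) (e k) = 0 := fun k => by
    rw [← metricForm_apply, map_add, LinearMap.add_apply, metricForm_apply, metricForm_apply,
      metric_timeVector, hu, metric_inverse_sum hG hdet fun i => (e i).2.2]
    ring
  have h2 : metric (timeVector n + u) (position q) = 0 := by
    rw [← metricForm_apply, map_add, LinearMap.add_apply, metricForm_apply, metricForm_apply,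
      metric_timeVector, hu, metric_sum_of_forall _ heq]
    simp [position]
  have h3 : metric (timeVector n + u) (levelGradient n h) = -h := by
    rw [← metricForm_apply, map_add, LinearMap.add_apply, metricForm_apply, metricForm_apply,
      metric_timeVector, hu, metric_sum_of_forall _ heN]
    simp [levelGradient]
  have h4 := congrArg (fun v : Ambient n => v.2.2) (eq_smul_normal hG hdet hq heq heN hD h1 h2)
  rw [h3] at h4
  have h5 : u.2.2 = ∑ i, ∑ j, G⁻¹ i j * ((e i).2.2 * (e j).2.2) := by
    rw [hu]
    simp only [Prod.snd_sum, Prod.smul_snd, smul_eq_mul, mul_assoc]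
  rw [← h5]
  simp only [Prod.snd_add, timeVector, levelGradient, position, Prod.smul_snd, smul_eq_mul,
    mul_zero, add_zero] at h4
  field_simp at h4
  linarith

end Pointwise

section Hypersurface

variable {M : Type*} [TopologicalSpace M] [ChartedSpace (EuclideanSpace ℝ (Fin n)) M]
  {F : M → Ambient n} {x : M} {h h₂ : ℝ}

theorem metric_normalPart_levelGradient
    (heN : ∀ i, metric (tangentVec F x i) (levelGradient n h) = 0) (w : Ambient n) :
    metric (normalPart F x w) (levelGradient n h) =
      metric w (levelGradient n h) + metric w (position (F x)) * (F x).2.1 := by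
  rw [normalPart, ← metricForm_apply, map_sub, map_add, map_smul, LinearMap.sub_apply,
    LinearMap.add_apply, LinearMap.smul_apply]
  simp only [metricForm_apply]
  rw [metric_sum_of_forall _ heN, metric_comm (position _), metric_levelGradient_position]
  simp

/-- The translator equation for a level set `ρ = H t`, where `h = H' t` and `h₂ = H'' t`. -/
theorem translator_equation (hq : F x ∈ space n) (hdet : (inducedMetric F x).det ≠ 0)
    (hy : 1 < (F x).2.1)
    (htl : ∃ c : Fin n → ℝ,
      metric (∑ i, c i • tangentVec F x i) (∑ i, c i • tangentVec F x i) < 0)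
    (htr : meanCurvatureVector F x = normalPart F x (timeVector n))
    (he : ∀ i, (tangentVec F x i).2.1 = h * (tangentVec F x i).2.2)
    (heq : ∀ i, metric (tangentVec F x i) (position (F x)) = 0)
    (hS : ∀ i j, (secondDeriv F x i j).2.1 = h * (secondDeriv F x i j).2.2 +
      h₂ * ((tangentVec F x i).2.2 * (tangentVec F x j).2.2))
    (hSq : ∀ i j, metric (secondDeriv F x i j) (position (F x)) =
      -(inducedMetric F x i j + (tangentVec F x i).2.2 * (tangentVec F x j).2.2)) :
    0 < (F x).2.1 ^ 2 - 1 - h ^ 2 ∧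
      (h₂ - (F x).2.1) * ((F x).2.1 ^ 2 - 1) =
        (h - n * (F x).2.1) * ((F x).2.1 ^ 2 - 1 - h ^ 2) := by
  have heN : ∀ i, metric (tangentVec F x i) (levelGradient n h) = 0 := fun i => by
    rw [metric_levelGradient, he]; ring
  have hD : 0 < (F x).2.1 ^ 2 - 1 - h ^ 2 := by
    obtain ⟨c, hc⟩ := htl
    refine discriminant_pos_of_timelike hq hy ?_ ?_ hc
    · simp only [Prod.fst_sum, Prod.snd_sum, Prod.smul_fst, Prod.smul_snd, smul_eq_mul, he,
        Finset.mul_sum]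
      exact Finset.sum_congr rfl fun i _ => by ring
    · rw [← metricForm_apply]
      simp [LinearMap.sum_apply, metricForm_apply, heq]
  refine ⟨hD, ?_⟩
  set G := inducedMetric F x with hGdef
  have hG : ∀ i j, G i j = metric (tangentVec F x i) (tangentVec F x j) := fun i j => rfl
  have hQ := sum_inverse_mul_time hG hdet hq heq heN hD.ne'
  -- Both sides are normal, so the product with the gradient keeps all the information, and
  -- tangential corrections drop out of it.
  have h1 := congrArg (fun v => metric v (levelGradient n h)) htr
  simp only [meanCurvatureVector, ← metricForm_apply, map_sum, map_smul, LinearMap.sum_apply,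
    LinearMap.smul_apply, secondFundamentalForm] at h1
  simp only [metricForm_apply, metric_normalPart_levelGradient heN] at h1
  rw [metric_levelGradient, metric_timeVector, show (position (F x)).2.2 = 0 from rfl] at h1
  simp only [metric_levelGradient, hS, hSq, timeVector, neg_zero, zero_mul, add_zero,
    smul_eq_mul, mul_one, zero_sub] at h1
  have hinv : G⁻¹ * G = 1 := Matrix.nonsing_inv_mul G (isUnit_iff_ne_zero.2 hdet)
  have htrace : ∑ i, ∑ j, G⁻¹ i j * G i j = n := by
    have : ∀ i, ∑ j, G⁻¹ i j * G i j = (G⁻¹ * G) i i := by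
      intro i
      rw [Matrix.mul_apply]
      refine Finset.sum_congr rfl fun j _ => ?_
      rw [hG j i, metric_comm, ← hG]
    simp [this, hinv]
  have h2 : (h₂ - (F x).2.1) * (∑ i, ∑ j, G⁻¹ i j *
      ((tangentVec F x i).2.2 * (tangentVec F x j).2.2)) - (F x).2.1 * n = -h := by
    rw [← h1, ← htrace, Finset.mul_sum, Finset.mul_sum, ← Finset.sum_sub_distrib]
    refine Finset.sum_congr rfl fun i _ => ?_
    rw [Finset.mul_sum, Finset.mul_sum, ← Finset.sum_sub_distrib]
    refine Finset.sum_congr rfl fun j _ => ?_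
    rw [← hGdef]
    ring
  linear_combination (-((F x).2.1 ^ 2 - 1 - h ^ 2)) * h2 + (h₂ - (F x).2.1) * hQ

/-- On the axis `χ = (0, 1, 0)` and `h = 0`, so the two formulas for the second derivatives give
`gᵢⱼ = (h₂ - 1) ∂ᵢt ∂ⱼt`: rank at most one, hence singular for `n ≥ 2`. -/
theorem one_lt_of_nondegenerate (hn : 2 ≤ n) (hq : F x ∈ space n)
    (hdet : (inducedMetric F x).det ≠ 0) (hmin : (F x).2.1 = 1 → h = 0)
    (hS : ∀ i j, (secondDeriv F x i j).2.1 = h * (secondDeriv F x i j).2.2 +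
      h₂ * ((tangentVec F x i).2.2 * (tangentVec F x j).2.2))
    (hSq : ∀ i j, metric (secondDeriv F x i j) (position (F x)) =
      -(inducedMetric F x i j + (tangentVec F x i).2.2 * (tangentVec F x j).2.2)) :
    1 < (F x).2.1 := by
  have hq1 := hq.1
  have hq2 := hq.2
  have h0 : 0 ≤ inner ℝ (F x).1 (F x).1 := real_inner_self_nonneg
  by_contra! hle
  have hy : (F x).2.1 = 1 := by nlinarith
  have hp : (F x).1 = 0 := by
    rw [← inner_self_eq_zero (𝕜 := ℝ)]
    rw [hy] at hq1
    linarith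
  apply hdet
  have hG : inducedMetric F x = Matrix.vecMulVec (fun i => (h₂ - 1) * (tangentVec F x i).2.2)
      (fun j => (tangentVec F x j).2.2) := by
    ext i j
    have h1 := hSq i j
    simp only [metric, position, hp, hy, inner_zero_right, hS, hmin hy] at h1
    rw [Matrix.vecMulVec_apply]
    linarith
  have : Nontrivial (Fin n) := Fin.nontrivial_iff_two_le.2 hn
  rw [hG, Matrix.det_vecMulVec]

end Hypersurface

end HESU

/-! ### Factoring one function locally through another. -/

section Factor

variable {E : Type*} [NormedAddCommGroup E] [NormedSpace ℝ E]

theorem eq_of_forall_hasDerivAt_zero_segment {f : E → ℝ} {s : Set E} (hs : Convex ℝ s)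
    {u v : E} (hu : u ∈ s) (hv : v ∈ s)
    (hf : ∀ w ∈ s, DifferentiableAt ℝ f w ∧ fderiv ℝ f w (v - u) = 0) : f v = f u := by
  have hmem : ∀ r ∈ Icc (0 : ℝ) 1, u + r • (v - u) ∈ s := fun r hr =>
    hs.add_smul_sub_mem hu hv hr
  have hd : ∀ r ∈ Icc (0 : ℝ) 1,
      HasDerivWithinAt (fun r : ℝ => f (u + r • (v - u))) 0 (Icc 0 1) r := by
    intro r hr
    obtain ⟨h1, h2⟩ := hf _ (hmem r hr)
    have h3 : HasDerivAt (fun r : ℝ => u + r • (v - u)) (v - u) r := by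
      simpa using ((hasDerivAt_id r).smul_const (v - u)).const_add u
    have h4 := h1.hasFDerivAt.comp_hasDerivAt r h3
    rw [h2] at h4
    exact h4.hasDerivWithinAt
  have := (convex_Icc (0 : ℝ) 1).norm_image_sub_le_of_norm_hasDerivWithin_le (C := 0) hd
    (by simp) (left_mem_Icc.2 zero_le_one) (right_mem_Icc.2 zero_le_one)
  simpa [sub_eq_zero] using this

/-- A function whose differential vanishes on the kernel of the nonzero differential of `T` is
locally a function of `T`. -/
theorem ContDiffAt.exists_eventually_eq_comp [CompleteSpace E] {k : WithTop ℕ∞} (hk : 1 ≤ k)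
    (hk' : k ≠ ∞) {T Y : E → ℝ} {z : E} (hT : ContDiffAt ℝ k T z) (hY : ContDiffAt ℝ k Y z)
    (hTz : fderiv ℝ T z ≠ 0)
    (hker : ∀ᶠ w in 𝓝 z, ∀ v, fderiv ℝ T w v = 0 → fderiv ℝ Y w v = 0) :
    ∃ H : ℝ → ℝ, ContDiffAt ℝ k H (T z) ∧ ∀ᶠ w in 𝓝 z, Y w = H (T w) := by
  have hk0 : k ≠ 0 := (zero_lt_one.trans_le hk).ne'
  set l := fderiv ℝ T z with hl
  obtain ⟨e, he⟩ : ∃ e, l e = 1 := by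
    obtain ⟨e, he⟩ : ∃ e, l e ≠ 0 := by
      by_contra! h
      exact hTz (ContinuousLinearMap.ext h)
    exact ⟨(l e)⁻¹ • e, by simp [he]⟩
  -- `Φ` straightens `T`: since `l e = 1`, `l ∘ Φ = T`, and the differential of `Φ` at `z` is the
  -- identity.
  set Φ : E → E := fun w => w + (T w - l w) • e with hΦ
  have hlΦ : ∀ w, l (Φ w) = T w := fun w => by simp [hΦ, he]
  have hΦc : ContDiffAt ℝ k Φ z :=
    contDiffAt_id.add ((hT.sub l.contDiff.contDiffAt).smul contDiffAt_const)
  have hΦd : HasFDerivAt Φ ((ContinuousLinearEquiv.refl ℝ E : E ≃L[ℝ] E) : E →L[ℝ] E) z := by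
    have h1 := (hasFDerivAt_id z).add
      (((hT.differentiableAt hk0).hasFDerivAt.sub l.hasFDerivAt).smul_const e)
    refine h1.congr_fderiv ?_
    ext v
    simp [hl]
  have hstr := hΦc.hasStrictFDerivAt' hΦd hk0
  set Ψ := hΦc.localInverse hΦd hk0
  have hΨz : Ψ (Φ z) = z := hΦc.localInverse_apply_image hΦd hk0
  have hΨc : ContDiffAt ℝ k Ψ (Φ z) := hΦc.to_localInverse hΦd hk0
  have hΨl : ∀ᶠ w in 𝓝 z, Ψ (Φ w) = w := hstr.eventually_left_inverse
  have hΨr : ∀ᶠ u in 𝓝 (Φ z), Φ (Ψ u) = u := hstr.eventually_right_inverse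
  have htend : Tendsto Ψ (𝓝 (Φ z)) (𝓝 z) := by
    have := hΨc.continuousAt.tendsto
    rwa [hΨz] at this
  have hdiff : ∀ {f : E → ℝ} {x : E}, ContDiffAt ℝ k f x →
      ∀ᶠ w in 𝓝 x, DifferentiableAt ℝ f w := fun h =>
    (h.eventually hk').mono fun w hw => hw.differentiableAt hk0
  have hΨd : ∀ᶠ u in 𝓝 (Φ z), DifferentiableAt ℝ Ψ u :=
    (hΨc.eventually hk').mono fun w hw => hw.differentiableAt hk0
  obtain ⟨ε, hε, hball⟩ := Metric.eventually_nhds_iff_ball.1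
    (hΨr.and (hΨd.and (htend.eventually ((hdiff hT).and ((hdiff hY).and hker)))))
  have hvan : ∀ u ∈ Metric.ball (Φ z) ε, DifferentiableAt ℝ (Y ∘ Ψ) u ∧
      ∀ v, l v = 0 → fderiv ℝ (Y ∘ Ψ) u v = 0 := by
    intro u hu
    obtain ⟨-, h2, h3, h4, h5⟩ := hball u hu
    refine ⟨h4.comp u h2, fun v hv => ?_⟩
    have hTΨ : T ∘ Ψ =ᶠ[𝓝 u] l := by
      filter_upwards [Metric.isOpen_ball.mem_nhds hu] with u' hu'
      rw [Function.comp_apply, ← hlΦ, (hball u' hu').1]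
    have h6 : fderiv ℝ (T ∘ Ψ) u = l := by
      rw [hTΨ.fderiv_eq, ContinuousLinearMap.fderiv]
    rw [fderiv_comp u h3 h2] at h6
    rw [fderiv_comp u h4 h2]
    apply h5
    have := congrArg (fun L : E →L[ℝ] ℝ => L v) h6
    simpa [hv] using this
  -- `H` is `Y` along the line through `Φ z` in direction `e`. In a ball, `Y ∘ Ψ` is constant along
  -- segments on which `l` is constant.
  refine ⟨fun τ => Y (Ψ (Φ z + (τ - T z) • e)), ?_, ?_⟩
  · have h1 : ContDiffAt ℝ k (fun τ : ℝ => Φ z + (τ - T z) • e) (T z) :=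
      contDiffAt_const.add ((contDiffAt_id.sub contDiffAt_const).smul contDiffAt_const)
    have h0 : Φ z + (T z - T z) • e = Φ z := by simp
    refine ContDiffAt.comp (T z) (g := Y) (f := fun τ => Ψ (Φ z + (τ - T z) • e)) ?_ ?_
    · simpa [hΨz] using hY
    · refine ContDiffAt.comp (T z) (g := Ψ) ?_ h1
      rwa [h0]
  · have hTc : ContinuousAt T z := hT.continuousAt
    have hΦcont : ContinuousAt Φ z := hΦc.continuousAt
    have e1 : ∀ᶠ w in 𝓝 z, Φ w ∈ Metric.ball (Φ z) ε :=
      hΦcont.eventually (Metric.ball_mem_nhds _ hε)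
    have e2 : ∀ᶠ w in 𝓝 z, Φ z + (T w - T z) • e ∈ Metric.ball (Φ z) ε := by
      have hc : ContinuousAt (fun w => Φ z + (T w - T z) • e) z := by fun_prop
      apply hc.eventually
      beta_reduce
      rw [sub_self, zero_smul, add_zero]
      exact Metric.ball_mem_nhds _ hε
    filter_upwards [e1, e2, hΨl] with w h1 h2 h3
    have h4 := eq_of_forall_hasDerivAt_zero_segment (convex_ball (Φ z) ε) h2 h1 (f := Y ∘ Ψ)
      fun u hu => ⟨(hvan u hu).1, (hvan u hu).2 _ (by simp [hlΦ, he])⟩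
    simpa [h3] using h4

end Factor

/-! ### Rotations and the image of an invariant hypersurface. -/

theorem exists_linearIsometryEquiv_det_eq_one {n : ℕ} (hn : 2 ≤ n)
    {u v : EuclideanSpace ℝ (Fin n)} (h : ‖u‖ = ‖v‖) :
    ∃ A : EuclideanSpace ℝ (Fin n) ≃ₗᵢ[ℝ] EuclideanSpace ℝ (Fin n),
      LinearMap.det (A.toLinearEquiv :
        EuclideanSpace ℝ (Fin n) →ₗ[ℝ] EuclideanSpace ℝ (Fin n)) = 1 ∧ A u = v := by
  have hdet : ∀ w : EuclideanSpace ℝ (Fin n), w ≠ 0 →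
      LinearMap.det ((ℝ ∙ w)ᗮ.reflection.toLinearEquiv :
        EuclideanSpace ℝ (Fin n) →ₗ[ℝ] EuclideanSpace ℝ (Fin n)) = -1 := by
    intro w hw
    have := (ℝ ∙ w)ᗮ.det_reflection
    rw [Submodule.orthogonal_orthogonal, finrank_span_singleton hw, pow_one] at this
    exact this
  by_cases huv : u = v
  · refine ⟨LinearIsometryEquiv.refl ℝ _, ?_, by simp [huv]⟩
    exact LinearMap.det_id
  -- One reflection takes `u` to `v`; a second, in a hyperplane containing `v`, restores determinant
  -- 1. Its normal `w` exists because `n ≥ 2`.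
  obtain ⟨w, hw, hw0⟩ : ∃ w ∈ (ℝ ∙ v)ᗮ, w ≠ 0 := by
    refine (Submodule.ne_bot_iff _).1 fun hbot => ?_
    have h1 := Submodule.finrank_add_finrank_orthogonal (ℝ ∙ v)
    rw [hbot, finrank_bot, finrank_euclideanSpace_fin] at h1
    have h2 : Module.finrank ℝ (ℝ ∙ v) ≤ 1 := (finrank_span_le_card {v}).trans (by simp)
    omega
  refine ⟨((ℝ ∙ (u - v))ᗮ.reflection).trans ((ℝ ∙ w)ᗮ.reflection), ?_, ?_⟩
  · have h1 : ((((ℝ ∙ (u - v))ᗮ.reflection).trans ((ℝ ∙ w)ᗮ.reflection)).toLinearEquiv :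
        EuclideanSpace ℝ (Fin n) →ₗ[ℝ] EuclideanSpace ℝ (Fin n)) =
        ((ℝ ∙ w)ᗮ.reflection.toLinearEquiv :
          EuclideanSpace ℝ (Fin n) →ₗ[ℝ] EuclideanSpace ℝ (Fin n)) ∘ₗ
        ((ℝ ∙ (u - v))ᗮ.reflection.toLinearEquiv :
          EuclideanSpace ℝ (Fin n) →ₗ[ℝ] EuclideanSpace ℝ (Fin n)) := rfl
    rw [h1, LinearMap.det_comp, hdet w hw0, hdet _ (sub_ne_zero.2 huv)]
    norm_num
  · rw [LinearIsometryEquiv.trans_apply, Submodule.reflection_sub h]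
    apply Submodule.reflection_mem_subspace_eq_self
    rw [Submodule.mem_orthogonal_singleton_iff_inner_right] at hw ⊢
    rwa [real_inner_comm]

namespace HESU

variable {n : ℕ} {M : Type*} [TopologicalSpace M] [ChartedSpace (EuclideanSpace ℝ (Fin n)) M]
  {F : M → Ambient n}

theorem space_one_le {q : Ambient n} (hq : q ∈ space n) : 1 ≤ q.2.1 := by
  have h1 := hq.1
  have h2 := hq.2
  have h0 : 0 ≤ inner ℝ q.1 q.1 := real_inner_self_nonneg
  nlinarith

theorem RotationallyInvariant.mem_of_norm_eq {S : Set (Ambient n)} (hn : 2 ≤ n)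
    (hS : RotationallyInvariant S) {q : Ambient n} (hq : q ∈ S)
    {p : EuclideanSpace ℝ (Fin n)} (hp : ‖q.1‖ = ‖p‖) : (p, q.2) ∈ S := by
  obtain ⟨A, hA, hAp⟩ := exists_linearIsometryEquiv_det_eq_one hn hp
  have := hS A hA q hq
  rwa [rotate, hAp] at this

variable [IsManifold (𝓡 n) ∞ M]

theorem contDiffOn_localParam (hF : ContMDiff (𝓡 n) 𝓘(ℝ, Ambient n) ∞ F) (x : M) :
    ContDiffOn ℝ ∞ (localParam F x) (extChartAt (𝓡 n) x).target :=
  (hF.comp_contMDiffOn (contMDiffOn_extChartAt_symm x)).contDiffOn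

/-- The projection to (x, t) is a countable union of locally Lipschitz images of subsets of ℝⁿ, so
its Hausdorff dimension is at most `n < n + 1`. -/
theorem dense_compl_image_range [SecondCountableTopology M]
    (hF : ContMDiff (𝓡 n) 𝓘(ℝ, Ambient n) ∞ F) :
    Dense ((fun q : Ambient n => (q.1, q.2.2)) '' range F)ᶜ := by
  obtain ⟨s, hs, hcov⟩ := TopologicalSpace.countable_cover_nhds
    fun x : M => extChartAt_source_mem_nhds (I := 𝓡 n) x
  apply dense_compl_of_dimH_lt_finrank
  have hsub : (fun q : Ambient n => (q.1, q.2.2)) '' range F ⊆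
      ⋃ x ∈ s, (fun w => ((localParam F x w).1, (localParam F x w).2.2)) ''
        (extChartAt (𝓡 n) x).target := by
    rintro _ ⟨_, ⟨y, rfl⟩, rfl⟩
    have hy : y ∈ ⋃ x ∈ s, (extChartAt (𝓡 n) x).source := hcov ▸ mem_univ y
    simp only [mem_iUnion] at hy ⊢
    obtain ⟨x, hx, hyx⟩ := hy
    refine ⟨x, hx, extChartAt (𝓡 n) x y, (extChartAt (𝓡 n) x).map_source hyx, ?_⟩
    simp only [localParam, Function.comp_apply, (extChartAt (𝓡 n) x).left_inv hyx]
  refine (dimH_mono hsub).trans_lt ?_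
  rw [dimH_bUnion hs]
  have hle : ∀ x ∈ s, dimH ((fun w => ((localParam F x w).1, (localParam F x w).2.2)) ''
      (extChartAt (𝓡 n) x).target) ≤ n := by
    intro x _
    have hc := contDiffOn_localParam hF x
    refine (dimH_image_le_of_locally_lipschitzOn fun w hw => ?_).trans
      ((dimH_mono (subset_univ _)).trans ?_)
    · have hw' := (isOpen_extChartAt_target (I := 𝓡 n) x).mem_nhds hw
      have h1 : ContDiffAt ℝ 1 (fun w => ((localParam F x w).1, (localParam F x w).2.2)) w := by
        have h2 := (hc.contDiffAt hw').of_le (m := 1) (by simp)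
        exact h2.fst.prodMk h2.snd.snd
      obtain ⟨K, t, ht, hKt⟩ := h1.exists_lipschitzOnWith
      exact ⟨K, t, nhdsWithin_le_nhds ht, hKt⟩
    · rw [Real.dimH_univ_eq_finrank, finrank_euclideanSpace_fin]
  refine (iSup₂_le hle).trans_lt ?_
  rw [Module.finrank_prod, finrank_euclideanSpace_fin, Module.finrank_self]
  exact_mod_cast Nat.lt_succ_self n

/-- Otherwise (ρ, t) is a submersion at `w` and covers an open set; with ρ = √(1 + |x|²), rotations
fill an open set of points (x, t), against `dense_compl_image_range`. -/
theorem fderiv_eq_zero_of_rotationallyInvariant [SecondCountableTopology M] (hn : 2 ≤ n)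
    (hF : ContMDiff (𝓡 n) 𝓘(ℝ, Ambient n) ∞ F) (hspace : ∀ x, F x ∈ space n)
    (hrot : RotationallyInvariant (range F)) (x : M) {w : EuclideanSpace ℝ (Fin n)}
    (hw : w ∈ (extChartAt (𝓡 n) x).target)
    (hT : fderiv ℝ (fun w => (localParam F x w).2.2) w ≠ 0) (v : EuclideanSpace ℝ (Fin n))
    (hv : fderiv ℝ (fun w => (localParam F x w).2.2) w v = 0) :
    fderiv ℝ (fun w => (localParam F x w).2.1) w v = 0 := by
  by_contra hYv
  have hO := (isOpen_extChartAt_target (I := 𝓡 n) x).mem_nhds hw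
  have hc : ContDiffAt ℝ 1 (localParam F x) w :=
    ((contDiffOn_localParam hF x).contDiffAt hO).of_le (by simp)
  have hYs := hc.snd.fst.hasStrictFDerivAt one_ne_zero
  have hTs := hc.snd.snd.hasStrictFDerivAt one_ne_zero
  set LY := fderiv ℝ (fun w => (localParam F x w).2.1) w
  set LT := fderiv ℝ (fun w => (localParam F x w).2.2) w
  obtain ⟨e, he⟩ : ∃ e, LT e ≠ 0 := by
    by_contra! h
    exact hT (ContinuousLinearMap.ext h)
  have hsurj : (LY.prod LT).range = ⊤ := by
    rw [LinearMap.range_eq_top]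
    rintro ⟨a, b⟩
    refine ⟨(b / LT e) • e + ((a - b / LT e * LY e) / LY v) • v, ?_⟩
    simp [hv, he, hYv]
  have hmap := (hYs.prodMk hTs).map_nhds_eq_of_surj hsurj
  have himage : (fun w => ((localParam F x w).2.1, (localParam F x w).2.2)) ''
      (extChartAt (𝓡 n) x).target ∈ 𝓝 ((localParam F x w).2.1, (localParam F x w).2.2) := by
    rw [← hmap]
    exact image_mem_map hO
  have hmem : ∀ w', localParam F x w' ∈ space n := fun w' => hspace _
  have hsq : ∀ q ∈ space n, √(1 + ‖q.1‖ ^ 2) = q.2.1 := by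
    intro q hq
    have h1 := hq.1
    rw [real_inner_self_eq_norm_sq] at h1
    rw [show 1 + ‖q.1‖ ^ 2 = q.2.1 ^ 2 by linarith, Real.sqrt_sq hq.2.le]
  have hcont : Continuous fun a : EuclideanSpace ℝ (Fin n) × ℝ => (√(1 + ‖a.1‖ ^ 2), a.2) := by
    fun_prop
  have hpre : (fun a : EuclideanSpace ℝ (Fin n) × ℝ => (√(1 + ‖a.1‖ ^ 2), a.2)) ⁻¹'
      ((fun w => ((localParam F x w).2.1, (localParam F x w).2.2)) ''
      (extChartAt (𝓡 n) x).target) ∈ 𝓝 ((localParam F x w).1, (localParam F x w).2.2) := by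
    apply hcont.continuousAt
    beta_reduce
    rwa [hsq _ (hmem w)]
  obtain ⟨⟨p, t⟩, ⟨w', -, hw'⟩, hnot⟩ :=
    mem_closure_iff_nhds.1 (dense_compl_image_range hF _) _ hpre
  apply hnot
  simp only [Prod.mk.injEq] at hw'
  have hnorm : ‖(localParam F x w').1‖ = ‖p‖ := by
    rw [← hsq _ (hmem w')] at hw'
    have h1 := Real.sqrt_inj (by positivity) (by positivity) |>.1 hw'.1
    exact (sq_eq_sq₀ (norm_nonneg _) (norm_nonneg _)).1 (by linarith)
  exact ⟨_, hrot.mem_of_norm_eq hn (mem_range_self _ : localParam F x w' ∈ range F) hnorm,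
    Prod.ext rfl hw'.2⟩

end HESU

/-! ### Derivatives of the constraint and of the relation ρ = H(t). -/

theorem HasDerivAt.fst_apply {E F : Type*} [NormedAddCommGroup E] [NormedSpace ℝ E]
    [NormedAddCommGroup F] [NormedSpace ℝ F] {f : ℝ → E × F} {f' : E × F} {s : ℝ}
    (hf : HasDerivAt f f' s) : HasDerivAt (fun s => (f s).1) f'.1 s :=
  (hasFDerivAt_fst (𝕜 := ℝ) (p := f s)).comp_hasDerivAt s hf

theorem HasDerivAt.snd_apply {E F : Type*} [NormedAddCommGroup E] [NormedSpace ℝ E]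
    [NormedAddCommGroup F] [NormedSpace ℝ F] {f : ℝ → E × F} {f' : E × F} {s : ℝ}
    (hf : HasDerivAt f f' s) : HasDerivAt (fun s => (f s).2) f'.2 s :=
  (hasFDerivAt_snd (𝕜 := ℝ) (p := f s)).comp_hasDerivAt s hf

theorem ContDiffAt.deriv_one {H : ℝ → ℝ} {t : ℝ} (hH : ContDiffAt ℝ 2 H t) :
    ContDiffAt ℝ 1 (deriv H) t :=
  (hH.fderiv_right (m := 1) (by norm_num)).clm_apply contDiffAt_const

theorem Filter.Eventually.comp_line {E : Type*} [NormedAddCommGroup E] [NormedSpace ℝ E]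
    {p : E → Prop} {z : E} (h : ∀ᶠ w in 𝓝 z, p w) (u : E) : ∀ᶠ s in 𝓝 (0 : ℝ), p (z + s • u) := by
  have hc : ContinuousAt (fun s : ℝ => z + s • u) 0 := by fun_prop
  refine hc.eventually ?_
  simpa using h

namespace HESU

section Derivatives

variable {n : ℕ} {E : Type*} [NormedAddCommGroup E] [NormedSpace ℝ E] {P : E → Ambient n} {z : E}

theorem metric_fderiv_position (hP : DifferentiableAt ℝ P z) (hs : ∀ᶠ w in 𝓝 z, P w ∈ space n)
    (u : E) : metric (fderiv ℝ P z u) (position (P z)) = 0 := by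
  have hB : HasDerivAt (fun s : ℝ => P (z + s • u)) (fderiv ℝ P z u) 0 :=
    hP.hasFDerivAt.hasLineDerivAt u
  have h1 := (hB.fst_apply.inner ℝ hB.fst_apply).sub
    (hB.snd_apply.fst_apply.mul hB.snd_apply.fst_apply)
  have h2 : (fun s : ℝ => inner ℝ (P (z + s • u)).1 (P (z + s • u)).1 -
      (P (z + s • u)).2.1 * (P (z + s • u)).2.1) =ᶠ[𝓝 0] fun _ => -1 := by
    filter_upwards [hs.comp_line u] with s hs using hs.1
  have h3 := h1.unique ((hasDerivAt_const (0 : ℝ) (-1 : ℝ)).congr_of_eventuallyEq h2)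
  simp only [zero_smul, add_zero] at h3
  rw [real_inner_comm (fderiv ℝ P z u).1] at h3
  simp only [metric, position]
  linarith

theorem hasDerivAt_fderiv_line (hP : ContDiffAt ℝ 2 P z) (u v : E) :
    HasDerivAt (fun s : ℝ => fderiv ℝ P (z + s • u) v) (fderiv ℝ (fderiv ℝ P) z u v) 0 := by
  have h1 : DifferentiableAt ℝ (fderiv ℝ P) z :=
    (hP.fderiv_right (m := 1) (by norm_num)).differentiableAt one_ne_zero
  have h2 : HasDerivAt (fun s : ℝ => fderiv ℝ P (z + s • u)) (fderiv ℝ (fderiv ℝ P) z u) 0 :=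
    h1.hasFDerivAt.hasLineDerivAt u
  simpa using h2.clm_apply (hasDerivAt_const (0 : ℝ) v)

/-- Differentiate `⟨∂ᵥP, χ⟩ = 0`; the derivative of `χ` is that of `P` without its `t`-component,
which accounts for the last term. -/
theorem metric_fderiv_fderiv_position (hP : ContDiffAt ℝ 2 P z)
    (hs : ∀ᶠ w in 𝓝 z, P w ∈ space n) (u v : E) :
    metric (fderiv ℝ (fderiv ℝ P) z u v) (position (P z)) =
      -(metric (fderiv ℝ P z u) (fderiv ℝ P z v) +
        (fderiv ℝ P z u).2.2 * (fderiv ℝ P z v).2.2) := by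
  have hB : HasDerivAt (fun s : ℝ => P (z + s • u)) (fderiv ℝ P z u) 0 :=
    (hP.differentiableAt two_ne_zero).hasFDerivAt.hasLineDerivAt u
  have hA := hasDerivAt_fderiv_line hP u v
  have h1 := (hA.fst_apply.inner ℝ hB.fst_apply).sub
    (hA.snd_apply.fst_apply.mul hB.snd_apply.fst_apply)
  have h2 : (fun s : ℝ => inner ℝ (fderiv ℝ P (z + s • u) v).1 (P (z + s • u)).1 -
      (fderiv ℝ P (z + s • u) v).2.1 * (P (z + s • u)).2.1) =ᶠ[𝓝 0] fun _ => 0 := by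
    have h3 := (hP.eventually (by simp)).and hs.eventually_nhds
    filter_upwards [h3.comp_line u] with s hs
    have h4 := metric_fderiv_position (hs.1.differentiableAt two_ne_zero) hs.2 v
    simp only [metric, position] at h4
    linarith
  have h3 := h1.unique ((hasDerivAt_const (0 : ℝ) (0 : ℝ)).congr_of_eventuallyEq h2)
  simp only [zero_smul, add_zero] at h3
  rw [real_inner_comm (fderiv ℝ P z u).1] at h3
  simp only [metric, position]
  linarith

theorem fderiv_level {H : ℝ → ℝ} (hP : DifferentiableAt ℝ P z)
    (hH : DifferentiableAt ℝ H (P z).2.2) (hY : ∀ᶠ w in 𝓝 z, (P w).2.1 = H (P w).2.2) (u : E) :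
    (fderiv ℝ P z u).2.1 = deriv H (P z).2.2 * (fderiv ℝ P z u).2.2 := by
  have hB : HasDerivAt (fun s : ℝ => P (z + s • u)) (fderiv ℝ P z u) 0 :=
    hP.hasFDerivAt.hasLineDerivAt u
  have hH' : HasDerivAt H (deriv H (P z).2.2) (P (z + (0 : ℝ) • u)).2.2 := by
    simpa using hH.hasDerivAt
  exact hB.snd_apply.fst_apply.unique
    ((hH'.comp (0 : ℝ) hB.snd_apply.snd_apply).congr_of_eventuallyEq (hY.comp_line u))

theorem fderiv_fderiv_level {H : ℝ → ℝ} (hP : ContDiffAt ℝ 2 P z)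
    (hH : ContDiffAt ℝ 2 H (P z).2.2) (hY : ∀ᶠ w in 𝓝 z, (P w).2.1 = H (P w).2.2) (u v : E) :
    (fderiv ℝ (fderiv ℝ P) z u v).2.1 =
      deriv H (P z).2.2 * (fderiv ℝ (fderiv ℝ P) z u v).2.2 +
        deriv (deriv H) (P z).2.2 * ((fderiv ℝ P z u).2.2 * (fderiv ℝ P z v).2.2) := by
  have hB : HasDerivAt (fun s : ℝ => P (z + s • u)) (fderiv ℝ P z u) 0 :=
    (hP.differentiableAt two_ne_zero).hasFDerivAt.hasLineDerivAt u
  have hA := hasDerivAt_fderiv_line hP u v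
  have hH' : HasDerivAt (deriv H) (deriv (deriv H) (P z).2.2) (P (z + (0 : ℝ) • u)).2.2 := by
    simpa using (hH.deriv_one.differentiableAt one_ne_zero).hasDerivAt
  have hT : ContinuousAt (fun w => (P w).2.2) z := hP.continuousAt.snd.snd
  have h2 : (fun s : ℝ => (fderiv ℝ P (z + s • u) v).2.1) =ᶠ[𝓝 0]
      fun s => deriv H (P (z + s • u)).2.2 * (fderiv ℝ P (z + s • u) v).2.2 := by
    have h3 := (hP.eventually (by simp)).and
      ((hT.eventually (hH.eventually (by simp))).and hY.eventually_nhds)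
    filter_upwards [h3.comp_line u] with s hs
    exact fderiv_level (hs.1.differentiableAt two_ne_zero) (hs.2.1.differentiableAt two_ne_zero)
      hs.2.2 v
  have h3 := hA.snd_apply.fst_apply.unique
    (((HasDerivAt.comp (h := fun s : ℝ => (P (z + s • u)).2.2) (0 : ℝ) hH'
      hB.snd_apply.snd_apply).fun_mul hA.snd_apply.snd_apply).congr_of_eventuallyEq h2)
  simp only [zero_smul, add_zero, Function.comp_apply] at h3
  rw [h3]
  ring

end Derivatives

/-- `H` solves the translator equation `(H'' - H)(H² - 1) = (H' - nH)(H² - 1 - H'²)` near `t`; it is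
the equation of `SolvesInverseODE` written for `H = cosh g`. -/
def SolvesCoshODEAt (n : ℕ) (H : ℝ → ℝ) (t : ℝ) : Prop :=
  ContDiffAt ℝ 2 H t ∧ ∀ᶠ s in 𝓝 t, 1 < H s ∧
    (deriv (deriv H) s - H s) * (H s ^ 2 - 1) =
      (deriv H s - n * H s) * (H s ^ 2 - 1 - deriv H s ^ 2)

/-- Since `H > 1`, one may divide by `H² - 1`: the pair `(H, H')` solves a first-order system with
locally Lipschitz right-hand side. -/
theorem SolvesCoshODEAt.eventuallyEq {n : ℕ} {H K : ℝ → ℝ} {t : ℝ} (hH : SolvesCoshODEAt n H t)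
    (hK : SolvesCoshODEAt n K t) (h0 : H t = K t) (h1 : deriv H t = deriv K t) :
    H =ᶠ[𝓝 t] K := by
  let v : ℝ × ℝ → ℝ × ℝ := fun p =>
    (p.2, p.1 + (p.2 - n * p.1) * (p.1 ^ 2 - 1 - p.2 ^ 2) / (p.1 ^ 2 - 1))
  have hne : H t ^ 2 - 1 ≠ 0 := by
    have := hH.2.self_of_nhds.1
    nlinarith
  have hv : ContDiffAt ℝ 1 v (H t, deriv H t) := by
    refine contDiffAt_snd.prodMk (contDiffAt_fst.add (ContDiffAt.div ?_ ?_ hne)) <;> fun_prop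
  obtain ⟨L, s, hs, hL⟩ := hv.exists_lipschitzOnWith
  have key : ∀ {J : ℝ → ℝ}, SolvesCoshODEAt n J t → J t = H t → deriv J t = deriv H t →
      ∀ᶠ x in 𝓝 t, HasDerivAt (fun x => (J x, deriv J x)) (v (J x, deriv J x)) x ∧
        (J x, deriv J x) ∈ s := by
    intro J hJ e0 e1
    have hc : ContinuousAt (fun x => (J x, deriv J x)) t :=
      hJ.1.continuousAt.prodMk hJ.1.deriv_one.continuousAt
    have hs' : ∀ᶠ x in 𝓝 t, (J x, deriv J x) ∈ s := by
      apply hc.eventually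
      beta_reduce
      rwa [e0, e1]
    filter_upwards [hs', hJ.1.eventually (by simp), hJ.2] with x hx hx1 hx2
    refine ⟨?_, hx⟩
    have hd := (hx1.differentiableAt two_ne_zero).hasDerivAt.prodMk
      (hx1.deriv_one.differentiableAt one_ne_zero).hasDerivAt
    refine hd.congr_deriv ?_
    have hne : J x ^ 2 - 1 ≠ 0 := by nlinarith [hx2.1]
    refine Prod.ext rfl ?_
    simp only [v]
    field_simp
    linarith [hx2.2]
  have := ODE_solution_unique_of_eventually (v := fun _ => v) (s := fun _ => s) (K := L) (t₀ := t)
    (Eventually.of_forall fun _ => hL) (key hH rfl rfl) (key hK h0.symm h1.symm) (by rw [h0, h1])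
  filter_upwards [this] with x hx using congrArg Prod.fst hx

theorem SolvesInverseODE.solvesCoshODEAt {n : ℕ} {a b : ℝ} {g : ℝ → ℝ}
    (hg : SolvesInverseODE n a b g) {t : ℝ} (ht : t ∈ Ioo a b) :
    SolvesCoshODEAt n (fun s => Real.cosh (g s)) t := by
  have hc : ∀ s ∈ Ioo a b, ContDiffAt ℝ 2 g s := fun s hs =>
    (hg.1.contDiffAt (isOpen_Ioo.mem_nhds hs)).of_le ENat.LEInfty.out
  refine ⟨Real.contDiff_cosh.contDiffAt.comp t (hc t ht), ?_⟩
  filter_upwards [isOpen_Ioo.mem_nhds ht] with s hs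
  have hd : ∀ x ∈ Ioo a b, HasDerivAt g (deriv g x) x := fun x hx =>
    ((hc x hx).differentiableAt two_ne_zero).hasDerivAt
  have hd1 : ∀ x ∈ Ioo a b,
      HasDerivAt (fun s => Real.cosh (g s)) (Real.sinh (g x) * deriv g x) x := fun x hx =>
    (Real.hasDerivAt_cosh (g x)).comp x (hd x hx)
  have hev : deriv (fun s => Real.cosh (g s)) =ᶠ[𝓝 s] fun x => Real.sinh (g x) * deriv g x := by
    filter_upwards [isOpen_Ioo.mem_nhds hs] with x hx using (hd1 x hx).deriv
  have hd2 := (HasDerivAt.comp (h := g) s (Real.hasDerivAt_sinh (g s)) (hd s hs)).fun_mul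
    ((hc s hs).deriv_one.differentiableAt one_ne_zero).hasDerivAt
  have hpos := hg.2.1 s hs
  have hsinh : 0 < Real.sinh (g s) := Real.sinh_pos_iff.2 hpos
  refine ⟨Real.one_lt_cosh.2 hpos.ne', ?_⟩
  rw [hev.deriv_eq, (hd1 s hs).deriv]
  rw [show deriv (fun x => Real.sinh (g x) * deriv g x) s = _ from hd2.deriv, hg.2.2 s hs]
  have hsq := Real.cosh_sq (g s)
  simp only [Function.comp_apply]
  field_simp
  rw [hsq]
  ring

/-! ### Local profiles and their continuation to the whole hypersurface. -/

section Hypersurface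

variable {n : ℕ} {M : Type*} [TopologicalSpace M] [ChartedSpace (EuclideanSpace ℝ (Fin n)) M]
  {F : M → Ambient n}

theorem localParam_extChartAt (x : M) : localParam F x (extChartAt (𝓡 n) x x) = F x := by
  simp [localParam]

theorem tendsto_extChartAt_symm (x : M) :
    Tendsto (extChartAt (𝓡 n) x).symm (𝓝 (extChartAt (𝓡 n) x x)) (𝓝 x) := by
  simpa using (continuousAt_extChartAt_symm (I := 𝓡 n) x).tendsto

variable [IsManifold (𝓡 n) ∞ M]

theorem contDiffAt_localParam (hF : ContMDiff (𝓡 n) 𝓘(ℝ, Ambient n) ∞ F) (x : M) :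
    ContDiffAt ℝ 2 (localParam F x) (extChartAt (𝓡 n) x x) :=
  ((contDiffOn_localParam hF x).contDiffAt (extChartAt_target_mem_nhds x)).of_le
    ENat.LEInfty.out

theorem IsTimelikeHypersurface.fderiv_height_ne_zero (hF : IsTimelikeHypersurface F) (x : M) :
    fderiv ℝ (fun w => (localParam F x w).2.2) (extChartAt (𝓡 n) x x) ≠ 0 := by
  obtain ⟨c, hc⟩ := hF.timelike x
  have hP := (contDiffAt_localParam hF.smooth x).differentiableAt two_ne_zero
  have hT := hP.hasFDerivAt.snd.snd
  have hq : ∀ i, metric (tangentVec F x i) (position (F x)) = 0 := fun i => by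
    have := metric_fderiv_position hP (Eventually.of_forall fun w => hF.mem_space _)
      (EuclideanSpace.single i 1)
    rwa [localParam_extChartAt] at this
  have hne := timeComponent_ne_zero_of_timelike (hF.mem_space x) (by
    rw [← metricForm_apply]
    simp [LinearMap.sum_apply, metricForm_apply, hq]) hc
  intro h0
  rw [hT.fderiv] at h0
  apply hne
  simp only [Prod.snd_sum, Prod.smul_snd, smul_eq_mul]
  refine Finset.sum_eq_zero fun i _ => ?_
  have := congrArg (fun L : EuclideanSpace ℝ (Fin n) →L[ℝ] ℝ => L (EuclideanSpace.single i 1)) h0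
  simp only [zero_apply] at this
  rw [show (tangentVec F x i).2.2 = 0 from this, mul_zero]

/-- The height is a submersion, hence open; this turns statements holding near `x` on `M` into
statements about heights near that of `x`. -/
theorem IsTimelikeHypersurface.nhds_le_map_height (hF : IsTimelikeHypersurface F) (x : M) :
    𝓝 (F x).2.2 ≤ map (fun y => (F y).2.2) (𝓝 x) := by
  have hT := ((contDiffAt_localParam hF.smooth x).snd.snd).hasStrictFDerivAt two_ne_zero
  have hne := hF.fderiv_height_ne_zero x
  have hmap := hT.map_nhds_eq_of_surj (by
    rw [LinearMap.range_eq_top]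
    exact LinearMap.surjective fun h => hne (ContinuousLinearMap.coe_injective h))
  rw [localParam_extChartAt] at hmap
  rw [← hmap]
  exact (Filter.map_mono (m := fun y => (F y).2.2) (tendsto_extChartAt_symm x))

theorem IsTimelikeHypersurface.exists_profile [SecondCountableTopology M] (hn : 2 ≤ n)
    (hF : IsTimelikeHypersurface F) (hrot : RotationallyInvariant (range F)) (x : M) :
    ∃ H : ℝ → ℝ, ContDiffAt ℝ 2 H (F x).2.2 ∧ ∀ᶠ y in 𝓝 x, (F y).2.1 = H (F y).2.2 := by
  have hP := contDiffAt_localParam hF.smooth x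
  have hne := hF.fderiv_height_ne_zero x
  have hcont : ContinuousAt (fderiv ℝ fun w => (localParam F x w).2.2) (extChartAt (𝓡 n) x x) :=
    hP.snd.snd.continuousAt_fderiv two_ne_zero
  obtain ⟨H, hH, hev⟩ := ContDiffAt.exists_eventually_eq_comp (by norm_num) (by simp)
    hP.snd.snd hP.snd.fst hne (by
      filter_upwards [hcont.eventually_ne hne, extChartAt_target_mem_nhds (I := 𝓡 n) x] with w h1 h2
      exact fderiv_eq_zero_of_rotationallyInvariant hn hF.smooth hF.mem_space hrot x h2 h1)
  rw [localParam_extChartAt] at hH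
  refine ⟨H, hH, ?_⟩
  filter_upwards [(continuousAt_extChartAt (I := 𝓡 n) x).eventually hev,
    extChartAt_source_mem_nhds (I := 𝓡 n) x] with y hy hy'
  simpa only [localParam, Function.comp_apply, (extChartAt (𝓡 n) x).left_inv hy'] using hy

theorem IsTimelikeHypersurface.profile_equation (hn : 2 ≤ n) (hF : IsTimelikeHypersurface F)
    (htrans : IsTranslator F) {x : M} {H : ℝ → ℝ} (hH : ContDiffAt ℝ 2 H (F x).2.2)
    (hev : ∀ᶠ y in 𝓝 x, (F y).2.1 = H (F y).2.2) :
    1 < (F x).2.1 ∧ 0 < (F x).2.1 ^ 2 - 1 - deriv H (F x).2.2 ^ 2 ∧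
      (deriv (deriv H) (F x).2.2 - (F x).2.1) * ((F x).2.1 ^ 2 - 1) =
        (deriv H (F x).2.2 - n * (F x).2.1) * ((F x).2.1 ^ 2 - 1 - deriv H (F x).2.2 ^ 2) := by
  have hP := contDiffAt_localParam hF.smooth x
  have hPs : ∀ᶠ w in 𝓝 (extChartAt (𝓡 n) x x), localParam F x w ∈ space n :=
    Eventually.of_forall fun w => hF.mem_space _
  have hY : ∀ᶠ w in 𝓝 (extChartAt (𝓡 n) x x),
      (localParam F x w).2.1 = H (localParam F x w).2.2 :=
    (tendsto_extChartAt_symm x).eventually hev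
  have he : ∀ i, (tangentVec F x i).2.1 = deriv H (F x).2.2 * (tangentVec F x i).2.2 := fun i => by
    have := fderiv_level (H := H) (hP.differentiableAt two_ne_zero)
      (by rw [localParam_extChartAt]; exact hH.differentiableAt two_ne_zero) hY
      (EuclideanSpace.single i 1)
    rwa [localParam_extChartAt] at this
  have heq : ∀ i, metric (tangentVec F x i) (position (F x)) = 0 := fun i => by
    have := metric_fderiv_position (hP.differentiableAt two_ne_zero) hPs
      (EuclideanSpace.single i 1)
    rwa [localParam_extChartAt] at this
  have hS : ∀ i j, (secondDeriv F x i j).2.1 = deriv H (F x).2.2 * (secondDeriv F x i j).2.2 +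
      deriv (deriv H) (F x).2.2 * ((tangentVec F x i).2.2 * (tangentVec F x j).2.2) :=
    fun i j => by
      have := fderiv_fderiv_level (H := H) hP (by rwa [localParam_extChartAt]) hY
        (EuclideanSpace.single i 1) (EuclideanSpace.single j 1)
      rwa [localParam_extChartAt] at this
  have hSq : ∀ i j, metric (secondDeriv F x i j) (position (F x)) =
      -(inducedMetric F x i j + (tangentVec F x i).2.2 * (tangentVec F x j).2.2) := fun i j => by
    have := metric_fderiv_fderiv_position hP hPs
      (EuclideanSpace.single i 1) (EuclideanSpace.single j 1)
    rwa [localParam_extChartAt] at this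
  -- Near this height `H` takes only values ρ ≥ 1, so the value 1 is a local minimum.
  have hmin : (F x).2.1 = 1 → deriv H (F x).2.2 = 0 := fun h1 => by
    refine IsLocalMin.deriv_eq_zero ?_
    refine hF.nhds_le_map_height x ?_
    rw [Filter.mem_map]
    filter_upwards [hev] with y hy
    simp only [mem_preimage, mem_ofPred_eq]
    rw [← hy, ← hev.self_of_nhds, h1]
    exact space_one_le (hF.mem_space y)
  have hy := one_lt_of_nondegenerate hn (hF.mem_space x) (hF.nondegenerate x) hmin hS hSq
  exact ⟨hy, translator_equation (hF.mem_space x) (hF.nondegenerate x) hy (hF.timelike x)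
    (htrans x) he heq hS hSq⟩

theorem IsTimelikeHypersurface.solvesCoshODEAt (hn : 2 ≤ n) (hF : IsTimelikeHypersurface F)
    (htrans : IsTranslator F) {x : M} {H : ℝ → ℝ} (hH : ContDiffAt ℝ 2 H (F x).2.2)
    (hev : ∀ᶠ y in 𝓝 x, (F y).2.1 = H (F y).2.2) : SolvesCoshODEAt n H (F x).2.2 := by
  refine ⟨hH, hF.nhds_le_map_height x ?_⟩
  have hc : ContinuousAt (fun y => (F y).2.2) x := hF.smooth.continuous.continuousAt.snd.snd
  rw [Filter.mem_map]
  filter_upwards [hc.eventually (hH.eventually (by simp)), hev.eventually_nhds] with y hy hy'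
  obtain ⟨h1, -, h2⟩ := hF.profile_equation hn htrans hy hy'
  rw [hy'.self_of_nhds] at h1 h2
  exact ⟨h1, h2⟩

theorem IsTimelikeHypersurface.profile_eventuallyEq (hF : IsTimelikeHypersurface F) {x : M}
    {H K : ℝ → ℝ} (hH : ∀ᶠ y in 𝓝 x, (F y).2.1 = H (F y).2.2)
    (hK : ∀ᶠ y in 𝓝 x, (F y).2.1 = K (F y).2.2) : H =ᶠ[𝓝 (F x).2.2] K := by
  refine hF.nhds_le_map_height x ?_
  rw [Filter.mem_map]
  filter_upwards [hH, hK] with y h1 h2 using h1.symm.trans h2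

theorem tau_eq_arcosh (q : Ambient n) : tau q = Real.arcosh q.2.1 := by
  rw [tau, Real.arcosh, add_comm]

theorem IsTimelikeHypersurface.exists_eq_cosh [ConnectedSpace M] [SecondCountableTopology M]
    (hn : 2 ≤ n) (hF : IsTimelikeHypersurface F) (htrans : IsTranslator F)
    (hrot : RotationallyInvariant (range F)) :
    ∃ (a t₀ b r : ℝ) (g fPlus fMinus : ℝ → ℝ), IsSpindleProfile n a t₀ b r g fPlus fMinus ∧
      ∀ x, (F x).2.2 ∈ Ioo a b ∧ (F x).2.1 = Real.cosh (g (F x).2.2) := by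
  choose H hHc hH using hF.exists_profile hn hrot
  have hODE : ∀ x, SolvesCoshODEAt n (H x) (F x).2.2 := fun x =>
    hF.solvesCoshODEAt hn htrans (hHc x) (hH x)
  have hone : ∀ x, 1 < (F x).2.1 := fun x => (hF.profile_equation hn htrans (hHc x) (hH x)).1
  have hFc := hF.smooth.continuous
  have hTc : Continuous fun y => (F y).2.2 := hFc.snd.snd
  have hYc : Continuous fun y => (F y).2.1 := hFc.snd.fst
  have hcompat : ∀ x, ∀ᶠ y in 𝓝 x, H y =ᶠ[𝓝 (F y).2.2] H x := fun x => by
    filter_upwards [(hH x).eventually_nhds] with y hy using hF.profile_eventuallyEq (hH y) hy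
  obtain ⟨x₀⟩ : Nonempty M := inferInstance
  obtain ⟨h1, h2, -⟩ := hF.profile_equation hn htrans (hHc x₀) (hH x₀)
  set s₁ := Real.arcosh (F x₀).2.1 with hs₁
  have hs₁pos : 0 < s₁ := Real.arcosh_pos h1
  have hcosh : Real.cosh s₁ = (F x₀).2.1 := Real.cosh_arcosh h1.le
  have hsinh : 0 < Real.sinh s₁ := Real.sinh_pos_iff.2 hs₁pos
  have hsq := Real.cosh_sq s₁
  have hv : deriv (H x₀) (F x₀).2.2 / Real.sinh s₁ ∈ Ioo (-1 : ℝ) 1 := by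
    rw [mem_Ioo, ← abs_lt, abs_div, abs_of_pos hsinh, div_lt_one hsinh, ← abs_of_pos hsinh, ← sq_lt_sq]
    rw [← hcosh] at h2
    linarith
  obtain ⟨a, t₀, b, r, g, fP, fM, hprof, hab, hg0, hg1, hga, hgb⟩ :=
    exists_isSpindleProfile hn (F x₀).2.2 hs₁pos hv
  refine ⟨a, t₀, b, r, g, fP, fM, hprof, ?_⟩
  have hgODE := hprof.inverse_ode
  -- Comparing germs, rather than values, makes `A` open at once; closedness needs the ODE.
  set A : Set M := {x | (F x).2.2 ∈ Ioo a b ∧ H x =ᶠ[𝓝 (F x).2.2] fun s => Real.cosh (g s)}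
  have hAval : ∀ x ∈ A, (F x).2.1 = Real.cosh (g (F x).2.2) := fun x hx =>
    ((hH x).self_of_nhds).trans hx.2.self_of_nhds
  have hopen : IsOpen A := by
    refine isOpen_iff_mem_nhds.2 fun x hx => ?_
    filter_upwards [hcompat x, hTc.continuousAt.eventually (isOpen_Ioo.mem_nhds hx.1),
      hTc.continuousAt.eventually hx.2.eventually_nhds] with y hy1 hy2 hy3
    exact ⟨hy2, hy1.trans hy3⟩
  have hclosed : IsClosed A := by
    refine isClosed_of_closure_subset fun x hx => ?_
    have hbot : (𝓝[A] x).NeBot := mem_closure_iff_nhdsWithin_neBot.1 hx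
    have hT : Tendsto (fun y => (F y).2.2) (𝓝[A] x) (𝓝 (F x).2.2) :=
      hTc.continuousAt.mono_left nhdsWithin_le_nhds
    have hY : Tendsto (fun y => (F y).2.1) (𝓝[A] x) (𝓝 (F x).2.1) :=
      hYc.continuousAt.mono_left nhdsWithin_le_nhds
    have hAA : ∀ᶠ y in 𝓝[A] x, y ∈ A := self_mem_nhdsWithin
    have hYg : Tendsto (fun y => Real.cosh (g (F y).2.2)) (𝓝[A] x) (𝓝 (F x).2.1) :=
      hY.congr' (hAA.mono hAval)
    -- At an end of the spindle `g → 0`, so ρ would be 1 at the limit point, contrary to `hone`.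
    have hend : ∀ l : Filter ℝ, Tendsto (fun y => (F y).2.2) (𝓝[A] x) l →
        ¬ Tendsto g l (𝓝 0) := fun l hl hg => by
      have h3 := (Real.continuous_cosh.tendsto 0).comp (hg.comp hl)
      rw [Real.cosh_zero] at h3
      exact (hone x).ne (tendsto_nhds_unique h3 hYg)
    have hmem : (F x).2.2 ∈ Ioo a b := by
      constructor
      · refine lt_of_le_of_ne (ge_of_tendsto hT (hAA.mono fun y hy => hy.1.1.le)) fun h => ?_
        rw [← h] at hT
        exact hend _ (tendsto_nhdsWithin_iff.2 ⟨hT, hAA.mono fun y hy => hy.1.1⟩) hga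
      · refine lt_of_le_of_ne (le_of_tendsto hT (hAA.mono fun y hy => hy.1.2.le)) fun h => ?_
        rw [h] at hT
        exact hend _ (tendsto_nhdsWithin_iff.2 ⟨hT, hAA.mono fun y hy => hy.1.2⟩) hgb
    have hK := hgODE.solvesCoshODEAt hmem
    refine ⟨hmem, (hODE x).eventuallyEq hK ?_ ?_⟩
    · rw [← (hH x).self_of_nhds]
      exact tendsto_nhds_unique hYg (hK.1.continuousAt.tendsto.comp hT)
    -- The derivatives agree at nearby points of `A`, since `H y` and `H x` have the same germ
    -- there; the limit gives equal Cauchy data at `x`.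
    · have h4 := (hODE x).1.deriv_one.continuousAt.tendsto.comp hT
      have h5 := hK.1.deriv_one.continuousAt.tendsto.comp hT
      refine tendsto_nhds_unique (h4.congr' ?_) h5
      filter_upwards [hAA, nhdsWithin_le_nhds (hcompat x)] with y hy1 hy2
      exact (hy2.symm.trans hy1.2).deriv_eq
  have hx₀ : x₀ ∈ A := by
    refine ⟨hab, (hODE x₀).eventuallyEq (hgODE.solvesCoshODEAt hab) ?_ ?_⟩
    · rw [← (hH x₀).self_of_nhds, hg0, hcosh]
    · have hgd : HasDerivAt g (deriv g (F x₀).2.2) (F x₀).2.2 :=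
        ((hgODE.1.contDiffAt (isOpen_Ioo.mem_nhds hab)).differentiableAt (by simp)).hasDerivAt
      have hd : HasDerivAt (fun s => Real.cosh (g s)) _ (F x₀).2.2 :=
        (Real.hasDerivAt_cosh _).comp (h := g) _ hgd
      rw [hd.deriv, hg0, hg1]
      field_simp
  have huniv : A = univ := IsClopen.eq_univ ⟨hclosed, hopen⟩ ⟨x₀, hx₀⟩
  intro x
  have hx : x ∈ A := huniv ▸ mem_univ x
  exact ⟨hx.1, hAval x hx⟩

end Hypersurface

end HESU

end

theorem theorem4p2 (n : ℕ) (hn : 2 ≤ n)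
    (M : Type*) [TopologicalSpace M] [T2Space M] [SecondCountableTopology M] [ConnectedSpace M]
    [ChartedSpace (EuclideanSpace ℝ (Fin n)) M] [IsManifold (𝓡 n) ∞ M]
    (F : M → HESU.Ambient n)
    (hF : HESU.IsTimelikeHypersurface F)
    (htrans : HESU.IsTranslator F)
    (hrot : HESU.RotationallyInvariant (Set.range F)) :
    ∃ S : Set (HESU.Ambient n), HESU.IsSpindle n S ∧
      ∃ U : Set (HESU.Ambient n), IsOpen U ∧ Set.range F = S ∩ U := by
  obtain ⟨a, t₀, b, r, g, fP, fM, hprof, hval⟩ := hF.exists_eq_cosh hn htrans hrot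
  have hpos := hprof.inverse_ode.2.1
  -- The relatively open subset is cut out by heights alone: the spindle meets each height in one
  -- rotation orbit, so invariance puts the whole orbit in the image once one point is there.
  refine ⟨HESU.rotationalSet n a b g, ⟨a, t₀, b, r, g, fP, fM, hprof, rfl⟩,
    (fun q : HESU.Ambient n => q.2.2) ⁻¹' Set.range fun x => (F x).2.2, ?_, ?_⟩
  · refine IsOpen.preimage (by fun_prop) (isOpen_iff_mem_nhds.2 ?_)
    rintro _ ⟨x, rfl⟩
    exact hF.nhds_le_map_height x (Filter.mem_map.2 (Filter.univ_mem' fun y => ⟨y, rfl⟩))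
  · apply Set.Subset.antisymm
    · rintro _ ⟨x, rfl⟩
      refine ⟨⟨hF.mem_space x, (hval x).1, ?_⟩, x, rfl⟩
      rw [HESU.tau_eq_arcosh, (hval x).2, Real.arcosh_cosh (hpos _ (hval x).1).le]
    · rintro ⟨p, y, t⟩ ⟨⟨hq, hqt, hqg⟩, x, hx⟩
      change (F x).2.2 = t at hx
      change HESU.tau (p, y, t) = g t at hqg
      have hy : y = (F x).2.1 := by
        rw [(hval x).2, hx, ← hqg, HESU.tau_eq_arcosh,
          Real.cosh_arcosh (HESU.space_one_le hq)]
      have hFx := hF.mem_space x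
      have hnorm : ‖(F x).1‖ = ‖p‖ := by
        have h1 := hFx.1
        have h2 := hq.1
        simp only [real_inner_self_eq_norm_sq] at h1 h2
        rw [← hy] at h1
        exact (sq_eq_sq₀ (norm_nonneg _) (norm_nonneg _)).1 (by linarith)
      have h3 := hrot.mem_of_norm_eq hn (Set.mem_range_self x) hnorm
      rwa [show (F x).2 = (y, t) from Prod.ext hy.symm hx] at h3
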